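/- Let $\mathcal I=(I,0,1,+,\cdot,<,\dots)$ be an o-minimal expansion of a real closed field; "definable" means definable in $\mathcal I$ with parameters, and derivatives are taken in the sense of the ordered field $I$. Let $A=(I,0,+)$ and let $G=(I,0,\oplus,<)$ be a definable (hence torsion-free) ordered group with domain $I$, neutral element $0$ and the order of $I$, such that $x\mapsto x\oplus s$ is differentiable on $I$ for every $s\in I$; write $\frac{\partial\oplus}{\partial x}(t,s)$ for its derivative at $t$. Let $U$ be a definable abelian group and let $$1\to A\xrightarrow{\,i\,}U\xrightarrow{\,j\,}G\to 1$$ be a definable extension, i.e. an exact sequence with $i,j$ definable homomorphisms. Then there is a definable $2$-cocycle $c:G\times G\to A$, i.e. a definable function with $c(h,k)-c(g\oplus h,k)+c(g,h\oplus k)-c(g,h)=0$ for all $g,h,k\in G$, which corresponds to this extension, i.e. $i(c(g,h))=s(g)s(h)s(g\oplus h)^{-1}$ for some definable map $s:G\to U$ with $j\circ s=\mathrm{id}_G$, such that the partial derivative $\frac{\partial c}{\partial x}(t,s)$ of $c$ in its first variable exists for all $t,s\in I$, and such that the following are equivalent: 1. $U$ is definably isomorphic, as a group, to $A\times G$; 2.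 there is a definable function $\alpha:G\to A$, differentiable at every point of $I$, such that $$\alpha'(s)\,\frac{\partial\oplus}{\partial x}(0,s)=\alpha'(0)+\frac{\partial c}{\partial x}(0,s)\qquad\text{for all } s\in G.$$ -/

import Mathlib

open FirstOrder

/-- Coordinates on a type `T` with values in `M`: an injective map of `T` into a Cartesian power
of `M` indexed by `Index`.  Definability of maps is read off in these coordinates. -/
class Coordinates (M : Type*) (T : Type*) where
  /-- the index type of the coordinates -/
  Index : Type
  /-- the coordinate tuple of a point -/
  coord : T → Index → M
  /-- a point is determined by its coordinates -/
  coord_injective : Function.Injective coord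

/-- `M` itself has one coordinate. -/
instance Coordinates.self (M : Type*) : Coordinates M M where
  Index := Unit
  coord x := fun _ => x
  coord_injective := fun _ _ h => congrFun h ()

/-- A subset of `M ^ n` has its `n` ambient coordinates. -/
instance Coordinates.subset (M : Type*) {n : ℕ} (S : Set (Fin n → M)) : Coordinates M S where
  Index := Fin n
  coord x := x.1
  coord_injective := Subtype.val_injective

/-- Coordinates of a pair: those of the two components, listed one after the other. -/
instance Coordinates.prod (M : Type*) (T S : Type*) [Coordinates M T] [Coordinates M S] :
    Coordinates M (T × S) where
  Index := Index M T ⊕ Index M S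
  coord p := Sum.elim (coord p.1) (coord p.2)
  coord_injective := by
    intro p q h
    refine Prod.ext (coord_injective (M := M) (funext fun i => ?_))
      (coord_injective (M := M) (funext fun i => ?_))
    · exact congrFun h (Sum.inl i)
    · exact congrFun h (Sum.inr i)

/-- A map `f : T → S` is definable (with parameters) in the `L`-structure `M` if its graph is. -/
def IsDefinableMap (L : Language) (M : Type*) [L.Structure M] {T S : Type*}
    [Coordinates M T] [Coordinates M S] (f : T → S) : Prop :=
  (Set.univ : Set M).Definable L (Set.range fun t : T =>
    Sum.elim (Coordinates.coord (M := M) t) (Coordinates.coord (M := M) (f t)))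

/-- A singleton, or an open interval with endpoints in the line or infinite. -/
inductive IsPointOrOpenInterval {M : Type*} [LinearOrder M] : Set M → Prop
  | singleton (a : M) : IsPointOrOpenInterval {a}
  | bounded (a b : M) : IsPointOrOpenInterval (Set.Ioo a b)
  | above (a : M) : IsPointOrOpenInterval (Set.Ioi a)
  | below (a : M) : IsPointOrOpenInterval (Set.Iio a)
  | line : IsPointOrOpenInterval Set.univ

/-- The `L`-structure on the ordered field `M` is an o-minimal expansion of the ordered field:
order, addition and multiplication are definable, and every subset of `M` that is definable with
parameters is a finite union of points and open intervals. -/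
structure IsOMinimalExpansion (L : Language) (M : Type*) [Field M] [LinearOrder M]
    [L.Structure M] : Prop where
  lt_definable : (Set.univ : Set M).Definable₂ L {p : M × M | p.1 < p.2}
  add_definable : IsDefinableMap L M (fun p : M × M => p.1 + p.2)
  mul_definable : IsDefinableMap L M (fun p : M × M => p.1 * p.2)
  ominimal : ∀ S : Set M, (Set.univ : Set M).Definable₁ L S →
    ∃ F : Set (Set M), F.Finite ∧ (∀ J ∈ F, IsPointOrOpenInterval J) ∧ S = ⋃₀ F

/-- `(M, 0, op, <)` is an `L`-definable ordered group, with domain `M`, neutral element `0` and the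
given order of `M`.  An ordered group is torsion-free. -/
structure IsDefinableOrderedGroup (L : Language) {M : Type*} [Zero M] [LinearOrder M]
    [L.Structure M] (op : M → M → M) : Prop where
  definable : IsDefinableMap L M (fun p : M × M => op p.1 p.2)
  assoc : ∀ x y z, op (op x y) z = op x (op y z)
  zero_op : ∀ x, op 0 x = x
  op_zero : ∀ x, op x 0 = x
  exists_inverse : ∀ x, ∃ y, op x y = 0 ∧ op y x = 0
  strictMono_left : ∀ z, StrictMono fun x => op x z
  strictMono_right : ∀ z, StrictMono fun x => op z x

/-- `f` has derivative `d` at `x`, in the ordered field `M`. -/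
def HasOrderedFieldDerivAt {M : Type*} [Field M] [LinearOrder M] (f : M → M) (d x : M) : Prop :=
  ∀ ε : M, 0 < ε → ∃ δ : M, 0 < δ ∧
    ∀ h : M, h ≠ 0 → |h| < δ → |(f (x + h) - f x) / h - d| < ε

/-- The group `U`, with domain a subset of `M ^ n`, is a definable group. -/
structure IsDefinableGroup (L : Language) {M : Type*} [L.Structure M] {n : ℕ}
    (U : Set (Fin n → M)) [Group U] : Prop where
  domain : (Set.univ : Set M).Definable L U
  mul : IsDefinableMap L M (fun p : U × U => p.1 * p.2)

/-- `0 → (M, +) → U → (M, op) → 0`, with maps `i` and `j`, is a definable extension: an exact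
sequence of definable groups and definable homomorphisms. -/
structure IsDefinableExtension (L : Language) {M : Type*} [Field M] [L.Structure M]
    (op : M → M → M) {n : ℕ} (U : Set (Fin n → M)) [Group U]
    (i : M → U) (j : U → M) : Prop where
  group : IsDefinableGroup L U
  i_definable : IsDefinableMap L M i
  j_definable : IsDefinableMap L M j
  i_hom : ∀ a b, i (a + b) = i a * i b
  j_hom : ∀ u v, j (u * v) = op (j u) (j v)
  i_injective : Function.Injective i
  j_surjective : Function.Surjective j
  exact : ∀ u, j u = 0 ↔ u ∈ Set.range i

/-- `c` is a definable `2`-cocycle of `(M, op)` with values in the trivial module `(M, +)`. -/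
structure IsDefinableTwoCocycle (L : Language) {M : Type*} [Field M] [L.Structure M]
    (op : M → M → M) (c : M → M → M) : Prop where
  definable : IsDefinableMap L M (fun p : M × M => c p.1 p.2)
  cocycle : ∀ g h k, c h k - c (op g h) k + c g (op h k) - c g h = 0

/-- `c` corresponds to the extension `(U, i, j)`: it is `c (g, h) = s(g) s(h) s(gh)⁻¹` for some
definable section `s` of `j`. -/
def CorrespondsToExtension (L : Language) {M : Type*} [L.Structure M]
    (op : M → M → M) {n : ℕ} (U : Set (Fin n → M)) [Group U]
    (i : M → U) (j : U → M) (c : M → M → M) : Prop :=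
  ∃ s : M → U, IsDefinableMap L M s ∧ (∀ g, j (s g) = g) ∧
    ∀ g h, i (c g h) = s g * s h * (s (op g h))⁻¹

/-- `U` is definably isomorphic, as a group, to `(M, +) × (M, op)`. -/
def IsDefinablyIsoProd (L : Language) {M : Type*} [Field M] [L.Structure M]
    (op : M → M → M) {n : ℕ} (U : Set (Fin n → M)) [Group U] : Prop :=
  ∃ φ : U ≃ M × M, IsDefinableMap L M (fun u : U => φ u) ∧
    ∀ u v, φ (u * v) = ((φ u).1 + (φ v).1, op (φ u).2 (φ v).2)

/-! A definable section of `j` exists by definable choice. As `U` is abelian, so is `G`, and the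
cocycle `c₀` of the section is symmetric. The heart of the proof is to make it differentiable in the
first variable by adding a coboundary (`exists_smoothing`). By o-minimality a definable unary
function is differentiable somewhere on every interval (`exists_ofDiffAt`), so the points at which
`c₀(·, g)` fails to be differentiable for all large `g` form a bounded set. The cocycle identity
with a large auxiliary argument then makes `c₀(·, k)` differentiable at `x` as soon as `x` and `x ⊕
k` lie outside a bounded interval `[p, q]`. The remaining singularities are removed by a function
`β` that equals `-c₀(·, k₀)` on a half-line containing `[p, q]` and its tangent line to the left of
it; here `k₀` translates the half-line beyond `q`.

`U` is definably `A × G` exactly when `c` is the coboundary of a definable function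
(`isDefinablyIsoProd_iff`). A given isomorphism need not respect `i` and `j`, but one of the two
factors is not killed by `j`. Definable subgroups of an ordered group on the line are trivial or
everything, so a nonzero definable homomorphism between two such groups is bijective, and inverting
it gives a definable splitting.

Being a coboundary is equivalent to the differential equation (`exists_primitive_iff`). If `c(g, h)
= b(g ⊕ h) - b(g) - b(h)`, then `b` is differentiable at one point, hence everywhere by translation,
and differentiating in `g` at `0` gives the equation. Conversely, a solution `α` turns `c` into a
cohomologous cocycle whose first partial derivative vanishes at `0`, hence everywhere by the cocycle
identity. That cocycle is constant, and a constant is a coboundary. -/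

open Filter Topology Set

set_option linter.unusedSectionVars false

/-- The predicate `p` on tuples is definable with parameters. -/
class DefPred (L : Language) {M : Type*} [L.Structure M] {ι : Type} (p : (ι → M) → Prop) :
    Prop where
  out : (Set.univ : Set M).Definable L {v | p v}

/-- The function `f` of tuples is definable with parameters. -/
class DefFun (L : Language) {M : Type*} [L.Structure M] {ι : Type} (f : (ι → M) → M) :
    Prop where
  out : (Set.univ : Set M).DefinableFun L f

/-- The unary function `f` is definable with parameters. -/
class DefFun₁ (L : Language) {M : Type*} [L.Structure M] (f : M → M) : Prop where
  out : DefFun L fun v : Fin 1 → M => f (v 0)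

/-- The binary function `f` is definable with parameters. -/
class DefFun₂ (L : Language) {M : Type*} [L.Structure M] (f : M → M → M) : Prop where
  out : DefFun L fun v : Fin 2 → M => f (v 0) (v 1)

/-! ### Closure properties of definable predicates and functions -/

section Definability

variable {L : Language} {M : Type*} [L.Structure M] {ι κ : Type}

theorem DefPred.congr {p q : (ι → M) → Prop} (hp : DefPred L p) (h : ∀ v, p v ↔ q v) :
    DefPred L q := by
  have : p = q := funext fun v => propext (h v)
  exact this ▸ hp

instance DefPred.and {p q : (ι → M) → Prop} [hp : DefPred L p] [hq : DefPred L q] :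
    DefPred L fun v => p v ∧ q v := ⟨hp.out.inter hq.out⟩

instance DefPred.or {p q : (ι → M) → Prop} [hp : DefPred L p] [hq : DefPred L q] :
    DefPred L fun v => p v ∨ q v := ⟨hp.out.union hq.out⟩

instance DefPred.not {p : (ι → M) → Prop} [hp : DefPred L p] :
    DefPred L fun v => ¬ p v := ⟨hp.out.compl⟩

instance DefPred.imp {p q : (ι → M) → Prop} [DefPred L p] [DefPred L q] :
    DefPred L fun v => p v → q v :=
  DefPred.congr (p := fun v => ¬ p v ∨ q v) inferInstance fun _ => imp_iff_not_or.symm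

instance DefPred.const (P : Prop) : DefPred L fun _ : ι → M => P := by
  by_cases h : P
  · exact ⟨by simp [h, Set.definable_univ]⟩
  · exact ⟨by simp [h, Set.definable_empty]⟩

theorem DefPred.exists_tuple [Finite κ] {p : (ι → M) → (κ → M) → Prop}
    (hp : DefPred L fun w : ι ⊕ κ → M => p (fun i => w (.inl i)) (fun k => w (.inr k))) :
    DefPred L fun v => ∃ u, p v u := ⟨hp.out.exists_of_finite⟩

theorem DefPred.reindex (e : ι → κ) {p : (ι → M) → Prop} (hp : DefPred L p) :
    DefPred L fun v : κ → M => p fun i => v (e i) := ⟨hp.out.preimage_comp e⟩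

theorem DefPred.reindex₂ {p : (ι → M) → M → Prop}
    (hp : DefPred L fun w : Option ι → M => p (fun i => w (some i)) (w none)) (e : ι → κ) (k : κ) :
    DefPred L fun u : κ → M => p (fun i => u (e i)) (u k) :=
  hp.reindex fun o => o.elim k e

/-- The bound variable is the extra coordinate `none` of `Option ι`, so nested quantifiers become
iterated `Option`s. In this form instance search establishes definability by following the shape of
a formula. -/
instance DefPred.exists {p : (ι → M) → M → Prop}
    [hp : DefPred L fun w : Option ι → M => p (fun i => w (some i)) (w none)] :
    DefPred L fun v => ∃ x, p v x := by
  have h := (hp.reindex (Sum.elim (fun _ => Sum.inr ()) (fun i => Sum.inl i) ∘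
    (fun o : Option ι => o.elim (Sum.inl ()) Sum.inr) : Option ι → ι ⊕ Unit))
  refine (DefPred.exists_tuple (p := fun v (u : Unit → M) => p v (u ())) h).congr fun v => ?_
  exact ⟨fun ⟨u, hu⟩ => ⟨_, hu⟩, fun ⟨x, hx⟩ => ⟨fun _ => x, hx⟩⟩

instance DefPred.forall {p : (ι → M) → M → Prop}
    [hp : DefPred L fun w : Option ι → M => p (fun i => w (some i)) (w none)] :
    DefPred L fun v => ∀ x, p v x :=
  DefPred.congr (p := fun v => ¬ ∃ x, ¬ p v x) inferInstance fun _ => not_exists_not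

instance DefFun.var (i : ι) : DefFun L fun v : ι → M => v i := ⟨.proj L⟩

instance DefFun.const (a : M) : DefFun L fun _ : ι → M => a :=
  ⟨L.definableFun_const _ (Set.mem_univ a)⟩

instance DefPred.eq {f g : (ι → M) → M} [hf : DefFun L f] [hg : DefFun L g] :
    DefPred L fun v => f v = g v := ⟨hf.out.ofPred_eq hg.out⟩

theorem DefFun.of_graph {f : (ι → M) → M}
    (h : DefPred L fun w : Option ι → M => w none = f fun i => w (some i)) : DefFun L f := by
  refine ⟨?_⟩
  have := h.out
  unfold Set.DefinableFun
  convert! this using 1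
  ext w
  simp [Function.tupleGraph, Function.comp_def, eq_comm]

theorem DefPred.comp [Finite κ] {p : (κ → M) → Prop} (hp : DefPred L p) {g : (ι → M) → κ → M}
    (hg : ∀ k, DefFun L fun v => g v k) : DefPred L fun v => p (g v) :=
  ⟨hp.out.preimage_map fun k => (hg k).out⟩

theorem DefFun.comp [Finite κ] {f : (κ → M) → M} (hf : DefFun L f) {g : (ι → M) → κ → M}
    (hg : ∀ k, DefFun L fun v => g v k) : DefFun L fun v => f (g v) :=
  ⟨hf.out.comp fun k => (hg k).out⟩

instance DefFun₁.comp {F : M → M} {f : (ι → M) → M} [hF : DefFun₁ L F] [hf : DefFun L f] :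
    DefFun L fun v => F (f v) :=
  hF.out.comp (g := fun v => ![f v]) fun k => by fin_cases k; exact hf

instance DefFun₂.comp {F : M → M → M} {f g : (ι → M) → M} [hF : DefFun₂ L F] [hf : DefFun L f]
    [hg : DefFun L g] : DefFun L fun v => F (f v) (g v) :=
  hF.out.comp (g := fun v => ![f v, g v]) fun k => by
    fin_cases k
    · exact hf
    · exact hg

instance DefFun.ite {p : (ι → M) → Prop} {f g : (ι → M) → M} [DecidablePred p] [hp : DefPred L p]
    [hf : DefFun L f] [hg : DefFun L g] : DefFun L fun v => if p v then f v else g v :=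
  ⟨hf.out.ite hp.out hg.out⟩

theorem DefFun₂.of_isDefinableMap {F : M → M → M}
    (h : IsDefinableMap L M fun p : M × M => F p.1 p.2) : DefFun₂ L F := by
  refine ⟨.of_graph ?_⟩
  have := DefPred.reindex (L := L) (M := M)
    (Sum.elim (Sum.elim (fun _ => some (0 : Fin 2)) fun _ => some 1) fun _ => none :
      (Unit ⊕ Unit) ⊕ Unit → Option (Fin 2)) ⟨h⟩
  refine this.congr fun w => ?_
  constructor
  · rintro ⟨⟨a, b⟩, h⟩
    have h1 := congrFun h (Sum.inl (Sum.inl ()))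
    have h2 := congrFun h (Sum.inl (Sum.inr ()))
    have h3 := congrFun h (Sum.inr ())
    simp only [Sum.elim_inl, Sum.elim_inr] at h1 h2 h3
    exact h3.symm.trans (congrArg₂ F h1 h2)
  · intro h
    refine ⟨(w (some 0), w (some 1)), ?_⟩
    funext k
    rcases k with (k | k) | k
    · rfl
    · rfl
    · exact h.symm

end Definability

/-- The unary predicate `p` is definable with parameters. -/
class DefPred₁ (L : Language) {M : Type*} [L.Structure M] (p : M → Prop) : Prop where
  out : DefPred L fun v : Fin 1 → M => p (v 0)

/-- The binary predicate `p` is definable with parameters. -/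
class DefPred₂ (L : Language) {M : Type*} [L.Structure M] (p : M → M → Prop) : Prop where
  out : DefPred L fun v : Fin 2 → M => p (v 0) (v 1)

section Definability

variable {L : Language} {M : Type*} [L.Structure M] {ι : Type}

instance DefPred₁.comp {p : M → Prop} {f : (ι → M) → M} [hp : DefPred₁ L p] [hf : DefFun L f] :
    DefPred L fun v => p (f v) :=
  hp.out.comp (g := fun v => ![f v]) fun k => by fin_cases k; exact hf

instance DefPred₂.comp {p : M → M → Prop} {f g : (ι → M) → M} [hp : DefPred₂ L p]
    [hf : DefFun L f] [hg : DefFun L g] : DefPred L fun v => p (f v) (g v) :=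
  hp.out.comp (g := fun v => ![f v, g v]) fun k => by
    fin_cases k
    · exact hf
    · exact hg

instance DefPred₁.of_defPred {p : M → Prop} [h : DefPred L fun v : Fin 1 → M => p (v 0)] :
    DefPred₁ L p := ⟨h⟩

instance DefPred₂.of_defPred {p : M → M → Prop}
    [h : DefPred L fun v : Fin 2 → M => p (v 0) (v 1)] : DefPred₂ L p := ⟨h⟩

end Definability

/-! ### Definability of the field operations and of suprema -/

section Order

variable {L : Language} {M : Type*} [Field M] [LinearOrder M] [L.Structure M]
  [hM : Fact (IsOMinimalExpansion L M)] {ι : Type}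

instance DefPred.lt {f g : (ι → M) → M} [hf : DefFun L f] [hg : DefFun L g] :
    DefPred L fun v => f v < g v :=
  DefPred.comp (κ := Fin 2) (p := fun w => w 0 < w 1) ⟨hM.out.lt_definable⟩
    (g := fun v => ![f v, g v]) fun k => by
    fin_cases k
    · exact hf
    · exact hg

instance DefPred.le {f g : (ι → M) → M} [DefFun L f] [DefFun L g] :
    DefPred L fun v => f v ≤ g v :=
  DefPred.congr (p := fun v => ¬ g v < f v) inferInstance fun _ => not_lt

instance DefFun₂.add : DefFun₂ L fun a b : M => a + b := .of_isDefinableMap hM.out.add_definable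
instance DefFun₂.mul : DefFun₂ L fun a b : M => a * b := .of_isDefinableMap hM.out.mul_definable

instance DefFun.add {f g : (ι → M) → M} [DefFun L f] [DefFun L g] :
    DefFun L fun v => f v + g v := DefFun₂.comp (F := fun a b => a + b)

instance DefFun.mul {f g : (ι → M) → M} [DefFun L f] [DefFun L g] :
    DefFun L fun v => f v * g v := DefFun₂.comp (F := fun a b => a * b)

instance DefFun.sub {f g : (ι → M) → M} [DefFun L f] [DefFun L g] :
    DefFun L fun v => f v - g v :=
  haveI : DefFun₂ L fun a b : M => a - b := ⟨.of_graph (DefPred.congr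
    (p := fun w => w none + w (some 1) = w (some 0)) inferInstance fun _ => eq_sub_iff_add_eq.symm)⟩
  DefFun₂.comp (F := fun a b => a - b)

instance DefFun.neg {f : (ι → M) → M} [DefFun L f] : DefFun L fun v => - f v := by
  simpa only [zero_sub] using (inferInstance : DefFun L fun v => 0 - f v)

instance DefFun.div {f g : (ι → M) → M} [DefFun L f] [DefFun L g] :
    DefFun L fun v => f v / g v :=
  -- The first disjunct accounts for the convention `x / 0 = 0`.
  have h : DefPred L fun w : Option (Fin 2) → M => (w (some 1) = 0 ∧ w none = 0) ∨
      (¬ w (some 1) = 0 ∧ w none * w (some 1) = w (some 0)) := inferInstance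
  haveI : DefFun₂ L fun a b : M => a / b := ⟨.of_graph (h.congr fun w => by
    by_cases h : w (some 1) = 0
    · simp [h]
    · simp [h, eq_div_iff])⟩
  DefFun₂.comp (F := fun a b => a / b)

instance DefFun.abs {f : (ι → M) → M} [DefFun L f] : DefFun L fun v => |f v| := by
  classical
  have : DefFun L fun v => if f v ≤ - f v then - f v else f v := inferInstance
  refine cast (congrArg _ (funext fun v => ?_)) this
  split_ifs with h
  · exact (sup_eq_right.2 h).symm
  · exact (sup_eq_left.2 (not_le.1 h).le).symm

/-- The least upper bound of `S`, and `0` if there is none. -/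
noncomputable def dsup (S : Set M) : M :=
  open Classical in if h : ∃ a, IsLUB S a then h.choose else 0

theorem dsup_eq_of_isLUB {S : Set M} {a : M} (h : IsLUB S a) : dsup S = a := by
  have h' : ∃ a, IsLUB S a := ⟨a, h⟩
  rw [dsup, dif_pos h']
  exact h'.choose_spec.unique h

instance DefPred.isLUB [Finite ι] {p : (ι → M) → M → Prop} {f : (ι → M) → M}
    [hp : DefPred L fun w : Option ι → M => p (fun i => w (some i)) (w none)] [hf : DefFun L f] :
    DefPred L fun v => IsLUB {x | p v x} (f v) := by
  have h1 : DefPred L fun u : Option (Option ι) → M => p (fun i => u (some (some i))) (u none) :=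
    hp.reindex₂ _ _
  have h2 : DefPred L fun u : Option (Option ι) → M =>
      p (fun i => u (some (some i))) (u (some none)) :=
    hp.reindex₂ _ _
  have hf' : DefFun L fun w : Option ι → M => f fun i => w (some i) :=
    hf.comp (g := fun w i => w (some i)) fun _ => inferInstance
  have : DefPred L fun v => (∀ x, p v x → x ≤ f v) ∧ ∀ b, (∀ x, p v x → x ≤ b) → f v ≤ b :=
    inferInstance
  exact this

instance DefFun.dsup [Finite ι] {p : (ι → M) → M → Prop}
    [hp : DefPred L fun w : Option ι → M => p (fun i => w (some i)) (w none)] :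
    DefFun L fun v => dsup {x | p v x} := by
  have h1 : DefPred L fun u : Option (Option ι) → M => p (fun i => u (some (some i))) (u none) :=
    hp.reindex₂ _ _
  have h2 : DefPred L fun u : Option (Option (Option ι)) → M =>
      p (fun i => u (some (some (some i)))) (u none) := hp.reindex₂ _ _
  have : DefPred L fun w : Option ι → M => IsLUB {x | p (fun i => w (some i)) x} (w none) ∨
      (¬ ∃ a, IsLUB {x | p (fun i => w (some i)) x} a) ∧ w none = 0 := inferInstance
  refine .of_graph (this.congr fun w => ?_)
  by_cases h : ∃ a, IsLUB {x | p (fun i => w (some i)) x} a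
  · obtain ⟨a, ha⟩ := h
    rw [dsup_eq_of_isLUB ha]
    constructor
    · rintro (h | h)
      · exact h.unique ha
      · exact (h.1 ⟨a, ha⟩).elim
    · exact fun h => .inl (h ▸ ha)
  · rw [_root_.dsup, dif_neg h]
    simp only [h, not_false_eq_true, true_and, or_iff_right_iff_imp]
    exact fun h' => (h ⟨_, h'⟩).elim

end Order

/-! ### One-sided germs, suprema and local boundedness in o-minimal structures -/

section OMinimal

variable {L : Language} {M : Type*} [Field M] [LinearOrder M] [L.Structure M]
  [hM : Fact (IsOMinimalExpansion L M)]

theorem IsPointOrOpenInterval.ordConnected {J : Set M} (h : IsPointOrOpenInterval J) :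
    J.OrdConnected := by
  cases h
  · exact ordConnected_singleton
  · exact ordConnected_Ioo
  · exact ordConnected_Ioi
  · exact ordConnected_Iio
  · exact ordConnected_univ

variable (L) in
theorem DefPred₁.isFiniteUnion (p : M → Prop) [hp : DefPred₁ L p] :
    ∃ F : Set (Set M), F.Finite ∧ (∀ J ∈ F, IsPointOrOpenInterval J) ∧ {x | p x} = ⋃₀ F :=
  hM.out.ominimal _ hp.out.out

/-- For each convex set, membership or non-membership holds eventually along the filter. -/
def DecidesConvex (l : Filter M) : Prop :=
  ∀ J : Set M, J.OrdConnected → (∀ᶠ x in l, x ∈ J) ∨ ∀ᶠ x in l, x ∉ J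

variable (L) in
-- A definable set is a finite union of convex sets, and the filter decides each of them. Applied at
-- one-sided neighbourhoods and at infinity, this is the main use of o-minimality.
theorem DecidesConvex.eventually_or {l : Filter M} (hl : DecidesConvex l) (p : M → Prop)
    [DefPred₁ L p] : (∀ᶠ x in l, p x) ∨ ∀ᶠ x in l, ¬ p x := by
  obtain ⟨F, hF, hJ, h⟩ := DefPred₁.isFiniteUnion L p
  have key : (∀ᶠ x in l, x ∈ ⋃₀ F) ∨ ∀ᶠ x in l, x ∉ ⋃₀ F := by
    clear h
    induction F, hF using Set.Finite.induction_on with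
    | empty => right; simp
    | @insert J F _ _ ih =>
      rw [sUnion_insert]
      rcases hl J (hJ J (mem_insert _ _)).ordConnected with h | h
      · left; filter_upwards [h] with x hx using Or.inl hx
      rcases ih fun K hK => hJ K (mem_insert_of_mem _ hK) with h' | h'
      · left; filter_upwards [h'] with x hx using Or.inr hx
      · right; filter_upwards [h, h'] with x hx hx' using not_or.2 ⟨hx, hx'⟩
  rw [← h] at key
  exact key

variable (L) in
-- Definable completeness: each of the finitely many nonempty pieces has a supremum, and the largest
-- one serves. It replaces the completeness of the reals throughout.
theorem DefPred₁.exists_isLUB (p : M → Prop) [DefPred₁ L p] (hne : ∃ x, p x)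
    (hb : BddAbove {x | p x}) [IsStrictOrderedRing M] : ∃ a, IsLUB {x | p x} a := by
  obtain ⟨F, hF, hJ, h⟩ := DefPred₁.isFiniteUnion L p
  have hne : (⋃₀ F).Nonempty := h ▸ hne
  rw [h] at hb ⊢
  clear h
  induction F, hF using Set.Finite.induction_on with
  | empty => simp at hne
  | @insert J F _ _ ih =>
    rw [sUnion_insert] at *
    have hJb : BddAbove J := hb.mono subset_union_left
    have hJ' : J.Nonempty → ∃ a, IsLUB J a := by
      intro hn
      cases hJ J (mem_insert _ _) with
      | singleton a => exact ⟨a, isLUB_singleton⟩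
      | bounded a b => exact ⟨b, isLUB_Ioo (nonempty_Ioo.1 hn)⟩
      | above a => exact (not_bddAbove_Ioi a hJb).elim
      | below a => exact ⟨a, isLUB_Iio⟩
      | line => exact (not_bddAbove_univ hJb).elim
    rcases J.eq_empty_or_nonempty with rfl | hJn
    · rw [empty_union] at *
      exact ih hb (fun K hK => hJ K (mem_insert_of_mem _ hK)) hne
    obtain ⟨a, ha⟩ := hJ' hJn
    rcases (⋃₀ F).eq_empty_or_nonempty with h0 | h0
    · rw [h0, union_empty]; exact ⟨a, ha⟩
    · obtain ⟨c, hc⟩ := ih (hb.mono subset_union_right)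
        (fun K hK => hJ K (mem_insert_of_mem _ hK)) h0
      exact ⟨_, ha.union hc⟩

theorem decidesConvex_atTop : DecidesConvex (atTop : Filter M) := by
  intro J hJ
  by_cases h : ∃ᶠ x in atTop, x ∈ J
  · left
    obtain ⟨x, hx⟩ := h.exists
    filter_upwards [eventually_ge_atTop x] with y hy
    obtain ⟨z, hz, hzy⟩ := (h.and_eventually (eventually_ge_atTop y)).exists
    exact hJ.out hx hz ⟨hy, hzy⟩
  · exact .inr (not_frequently.1 h)

theorem decidesConvex_atBot : DecidesConvex (atBot : Filter M) := by
  intro J hJ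
  by_cases h : ∃ᶠ x in atBot, x ∈ J
  · left
    obtain ⟨x, hx⟩ := h.exists
    filter_upwards [eventually_le_atBot x] with y hy
    obtain ⟨z, hz, hzy⟩ := (h.and_eventually (eventually_le_atBot y)).exists
    exact hJ.out hz hx ⟨hzy, hy⟩
  · exact .inr (not_frequently.1 h)

variable [TopologicalSpace M] [OrderTopology M] [IsStrictOrderedRing M]

theorem decidesConvex_nhdsGT (a : M) : DecidesConvex (𝓝[>] a) := by
  intro J hJ
  by_cases h : ∃ᶠ x in 𝓝[>] a, x ∈ J
  · left
    obtain ⟨x, hx, hxa⟩ := (h.and_eventually self_mem_nhdsWithin).exists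
    filter_upwards [Ioo_mem_nhdsGT hxa] with y hy
    obtain ⟨z, hz, hzy⟩ := (h.and_eventually (Ioo_mem_nhdsGT hy.1)).exists
    exact hJ.out hz hx ⟨hzy.2.le, hy.2.le⟩
  · exact .inr (not_frequently.1 h)

theorem decidesConvex_nhdsLT (a : M) : DecidesConvex (𝓝[<] a) := by
  intro J hJ
  by_cases h : ∃ᶠ x in 𝓝[<] a, x ∈ J
  · left
    obtain ⟨x, hx, hxa⟩ := (h.and_eventually self_mem_nhdsWithin).exists
    filter_upwards [Ioo_mem_nhdsLT hxa] with y hy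
    obtain ⟨z, hz, hzy⟩ := (h.and_eventually (Ioo_mem_nhdsLT hy.2)).exists
    exact hJ.out hx hz ⟨hy.1.le, hzy.1.le⟩
  · exact .inr (not_frequently.1 h)

theorem exists_Ioo_of_eventually_nhdsGT {a b : M} (hab : a < b) {p : M → Prop}
    (h : ∀ᶠ x in 𝓝[>] a, p x) : ∃ c, a < c ∧ c ≤ b ∧ ∀ x ∈ Ioo a c, p x := by
  obtain ⟨c, hc, hc'⟩ := (mem_nhdsGT_iff_exists_Ioo_subset' hab).1 h
  exact ⟨min b c, lt_min hab hc, min_le_left _ _, fun x hx =>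
    hc' ⟨hx.1, hx.2.trans_le (min_le_right _ _)⟩⟩

theorem exists_Ioo_of_eventually_nhdsLT {a b : M} (hab : a < b) {p : M → Prop}
    (h : ∀ᶠ x in 𝓝[<] b, p x) : ∃ c, a ≤ c ∧ c < b ∧ ∀ x ∈ Ioo c b, p x := by
  obtain ⟨c, hc, hc'⟩ := (mem_nhdsLT_iff_exists_Ioo_subset' hab).1 h
  exact ⟨max a c, le_max_left _ _, max_lt hab hc, fun x hx =>
    hc' ⟨(le_max_right _ _).trans_lt hx.1, hx.2⟩⟩

/-- `p` holds on some nonempty open subinterval of `(a, b)`. -/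
def HoldsOnSubinterval (a b : M) (p : M → Prop) : Prop :=
  ∃ a' b', a ≤ a' ∧ a' < b' ∧ b' ≤ b ∧ ∀ x ∈ Ioo a' b', p x

variable (L) in
-- The germ of `p` to the right of `a` is decided: either `p` holds there, or it fails there and `q`
-- takes over.
theorem HoldsOnSubinterval.of_or {a b : M} (hab : a < b) {p q : M → Prop} [DefPred₁ L p]
    (h : ∀ x ∈ Ioo a b, p x ∨ q x) : HoldsOnSubinterval a b p ∨ HoldsOnSubinterval a b q := by
  rcases (decidesConvex_nhdsGT a).eventually_or L p with h' | h'
  · obtain ⟨c, hac, hcb, hc⟩ := exists_Ioo_of_eventually_nhdsGT hab h'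
    exact .inl ⟨a, c, le_rfl, hac, hcb, hc⟩
  · obtain ⟨c, hac, hcb, hc⟩ := exists_Ioo_of_eventually_nhdsGT hab h'
    exact .inr ⟨a, c, le_rfl, hac, hcb, fun x hx =>
      (h x ⟨hx.1, hx.2.trans_le hcb⟩).resolve_left (hc x hx)⟩

variable (L) in
-- Otherwise `|γ|` tends to infinity on both sides of every point of the interval. This contradicts
-- the existence of last points of sublevel sets to the left of a fixed `e`.
theorem exists_abs_le_on_subinterval {a b : M} (hab : a < b) (γ : M → M) [DefFun₁ L γ] :
    ∃ N, HoldsOnSubinterval a b fun x => |γ x| ≤ N := by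
  by_contra hcon
  push Not at hcon
  have hr : ∀ x ∈ Ioo a b, ∀ N, ∀ᶠ y in 𝓝[>] x, N < |γ y| := by
    intro x hx N
    rcases (decidesConvex_nhdsGT x).eventually_or L (fun y => |γ y| ≤ N) with h | h
    · obtain ⟨c, hac, hcb, hc⟩ := exists_Ioo_of_eventually_nhdsGT hx.2 h
      exact (hcon N ⟨x, c, hx.1.le, hac, hcb, hc⟩).elim
    · simpa using h
  have hl : ∀ x ∈ Ioo a b, ∀ N, ∀ᶠ y in 𝓝[<] x, N < |γ y| := by
    intro x hx N
    rcases (decidesConvex_nhdsLT x).eventually_or L (fun y => |γ y| ≤ N) with h | h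
    · obtain ⟨c, hac, hcb, hc⟩ := exists_Ioo_of_eventually_nhdsLT hx.1 h
      exact (hcon N ⟨c, x, hac, hcb, hx.2.le, hc⟩).elim
    · simpa using h
  obtain ⟨e, hae, heb⟩ := exists_between hab
  -- Near `e`, either `|γ|` is strictly increasing, which is impossible because it is unbounded just
  -- to the left of any point, or no point has all later values larger than its own.
  rcases (decidesConvex_nhdsLT e).eventually_or L (fun x => ∀ y, x < y → y < e → |γ x| < |γ y|)
    with h | h
  · obtain ⟨d, had, hde, hd⟩ := exists_Ioo_of_eventually_nhdsLT hae h
    obtain ⟨y, hdy, hye⟩ := exists_between hde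
    obtain ⟨x, hx, hx'⟩ := ((hl y ⟨had.trans_lt hdy, hye.trans heb⟩ |γ y|).and
      (Ioo_mem_nhdsLT hdy)).exists
    exact lt_asymm hx (hd x ⟨hx'.1, hx'.2.trans hye⟩ y hx'.2 hye)
  · obtain ⟨d, had, hde, hd⟩ := exists_Ioo_of_eventually_nhdsLT hae h
    obtain ⟨z, hdz, hze⟩ := exists_between hde
    obtain ⟨t, hzt, hte, ht⟩ := exists_Ioo_of_eventually_nhdsLT hze (hl e ⟨hae, heb⟩ |γ z|)
    -- `s` is the last point before `e` with `|γ s| ≤ |γ z|`: it lies below `e` because `|γ|` blows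
    -- up at `e`, and it is attained because `|γ|` blows up to the left of `s`. All later values are
    -- therefore larger than `|γ s|`.
    obtain ⟨s, hs⟩ := DefPred₁.exists_isLUB L (fun x => z ≤ x ∧ x < e ∧ |γ x| ≤ |γ z|)
      ⟨z, le_rfl, hze, le_rfl⟩ ⟨e, fun x hx => hx.2.1.le⟩
    have hzs : z ≤ s := hs.1 ⟨le_rfl, hze, le_rfl⟩
    have hst : s ≤ t := hs.2 fun x hx => le_of_not_gt fun hxt =>
      (ht x ⟨hxt, hx.2.1⟩).not_ge hx.2.2
    have hse := hst.trans_lt hte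
    have hds := hdz.trans_le hzs
    have hmem : |γ s| ≤ |γ z| := by
      by_contra hns
      obtain ⟨u, hu, hus, huu⟩ := exists_Ioo_of_eventually_nhdsLT hds
        (hl s ⟨had.trans_lt hds, hse.trans heb⟩ |γ z|)
      refine hus.not_ge (hs.2 fun x hx => le_of_not_gt fun hux => ?_)
      rcases (hs.1 hx).lt_or_eq with h1 | h1
      · exact (huu x ⟨hux, h1⟩).not_ge hx.2.2
      · exact hns (h1 ▸ hx.2.2)
    refine hd s ⟨hds, hse⟩ fun y hsy hye => lt_of_not_ge fun hy => ?_
    exact hsy.not_ge (hs.1 ⟨hzs.trans hsy.le, hye, hy.trans hmem⟩)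

end OMinimal

/-! ### Definable choice -/

section Choice

variable {L : Language} {M : Type*} [Field M] [LinearOrder M] [L.Structure M]
  [hM : Fact (IsOMinimalExpansion L M)] [IsStrictOrderedRing M] {ι : Type} [Finite ι]

theorem DefPred.section {p : (ι → M) → M → Prop}
    (hp : DefPred L fun w : Option ι → M => p (fun i => w (some i)) (w none)) (v : ι → M) :
    DefPred₁ L (p v) :=
  ⟨hp.comp (g := fun u : Fin 1 → M => fun o : Option ι => o.elim (u 0) v) fun k => by
    cases k
    · exact DefFun.var 0
    · exact DefFun.const _⟩

variable (L) in
-- `a` is the infimum of `S`, written as the supremum of its lower bounds. If it is not in `S`, then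
-- `S` contains an interval starting at `a`, and the midpoint of the longest such interval of length
-- at most `1` is chosen. The cap `1` keeps the supremum finite.
theorem exists_pick (S : M → Prop) [DefPred₁ L S] (hS : ∃ y, S y) (h0 : ∀ y, S y → 0 ≤ y) :
    let a := dsup {z | ∀ y, S y → z ≤ y}
    S a ∨ S (a + dsup {t | t ≤ 1 ∧ ∀ y, a < y → y < a + t → S y} / 2) := by
  intro a
  by_cases hSa : S a
  · exact .inl hSa
  right
  let _ := Preorder.topology M
  have : OrderTopology M := ⟨rfl⟩
  obtain ⟨y₀, hy₀⟩ := hS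
  have ha : IsLUB {z | ∀ y, S y → z ≤ y} a := by
    obtain ⟨b, hb⟩ := DefPred₁.exists_isLUB L (fun z => ∀ y, S y → z ≤ y) ⟨0, h0⟩
      ⟨y₀, fun z hz => hz _ hy₀⟩
    have : a = b := dsup_eq_of_isLUB hb
    exact this ▸ hb
  have haS : ∀ y, S y → a ≤ y := fun y hy => ha.2 fun z hz => hz y hy
  have hev : ∀ᶠ x in 𝓝[>] a, S x := by
    refine ((decidesConvex_nhdsGT a).eventually_or L S).resolve_right fun h => ?_
    obtain ⟨c, hac, -, hc⟩ := exists_Ioo_of_eventually_nhdsGT (lt_add_one a) h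
    refine hac.not_ge (ha.1 fun y hy => le_of_not_gt fun hyc => ?_)
    exact hc y ⟨(haS y hy).lt_of_ne fun h => hSa (h ▸ hy), hyc⟩ hy
  obtain ⟨c, hac, hc1, hc⟩ := exists_Ioo_of_eventually_nhdsGT (lt_add_one a) hev
  have hcT : c - a ≤ 1 ∧ ∀ y, a < y → y < a + (c - a) → S y :=
    ⟨by linarith, fun y h1 h2 => hc y ⟨h1, by linarith⟩⟩
  obtain ⟨t, ht⟩ := DefPred₁.exists_isLUB L (fun t => t ≤ 1 ∧ ∀ y, a < y → y < a + t → S y)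
    ⟨c - a, hcT⟩ ⟨1, fun t ht => ht.1⟩
  rw [dsup_eq_of_isLUB ht]
  have ht0 : 0 < t := (sub_pos.2 hac).trans_le (ht.1 hcT)
  obtain ⟨u, hu, hut⟩ := (lt_isLUB_iff ht).1 (half_lt_self ht0)
  exact hu.2 _ (by linarith) (by linarith)

theorem exists_defFun_of_nonneg (p : (ι → M) → M → Prop)
    [hp : DefPred L fun w : Option ι → M => p (fun i => w (some i)) (w none)]
    (h0 : ∀ v y, p v y → 0 ≤ y) :
    ∃ f : (ι → M) → M, DefFun L f ∧ ∀ v, (∃ y, p v y) → p v (f v) := by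
  classical
  have h2 : DefPred L fun u : Option (Option ι) → M => p (fun i => u (some (some i))) (u none) :=
    hp.reindex₂ _ _
  have ha : DefFun L fun v => dsup {z | ∀ y, p v y → z ≤ y} := inferInstance
  set a := fun v => dsup {z | ∀ y, p v y → z ≤ y} with haa
  have ha2 : DefFun L fun w : Option (Option ι) → M => a fun i => w (some (some i)) :=
    ha.comp (g := fun w i => w (some (some i))) fun _ => inferInstance
  have hpa : DefPred L fun v => p v (a v) :=
    hp.comp (g := fun v o => o.elim (a v) v) fun k => by
      cases k
      · exact ha
      · exact DefFun.var _
  have h3 : DefFun L fun v => dsup {t | t ≤ 1 ∧ ∀ y, a v < y → y < a v + t → p v y} :=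
    inferInstance
  have h4 : DefFun L fun v => a v + dsup {t | t ≤ 1 ∧ ∀ y, a v < y → y < a v + t → p v y} / 2 :=
    inferInstance
  refine ⟨fun v => if p v (a v) then a v else
    a v + dsup {t | t ≤ 1 ∧ ∀ y, a v < y → y < a v + t → p v y} / 2, inferInstance, fun v hv => ?_⟩
  have := hp.section v
  rcases exists_pick L (p v) hv (h0 v) with h | h
  · beta_reduce
    rw [if_pos h]; exact h
  · beta_reduce
    split_ifs with h'
    · exact h'
    · exact h

/-- Definable choice. -/
theorem exists_defFun (p : (ι → M) → M → Prop)
    [hp : DefPred L fun w : Option ι → M => p (fun i => w (some i)) (w none)] :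
    ∃ f : (ι → M) → M, DefFun L f ∧ ∀ v, (∃ y, p v y) → p v (f v) := by
  classical
  have hn : DefPred L fun w : Option ι → M => p (fun i => w (some i)) (-w none) :=
    hp.comp (g := fun w o => o.elim (-w none) fun i => w (some i)) fun k => by
      cases k
      · exact inferInstanceAs (DefFun L fun w : Option ι → M => -w none)
      · exact DefFun.var _
  -- A nonnegative member is chosen if there is one; otherwise the reflected set has a nonnegative
  -- member.
  obtain ⟨f, hf, hf'⟩ := exists_defFun_of_nonneg (L := L) (fun v y => 0 ≤ y ∧ p v y)
    fun _ _ h => h.1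
  obtain ⟨g, hg, hg'⟩ := exists_defFun_of_nonneg (L := L) (fun v y => 0 ≤ y ∧ p v (-y))
    fun _ _ h => h.1
  refine ⟨fun v => if ∃ y, 0 ≤ y ∧ p v y then f v else - g v, inferInstance, fun v ⟨y, hy⟩ => ?_⟩
  beta_reduce
  split_ifs with h
  · exact (hf' v h).2
  · refine (hg' v ⟨-y, ?_, by simpa using hy⟩).2
    exact neg_nonneg.2 (le_of_not_ge fun h' => h ⟨y, h', hy⟩)

/-- Induction on the number of coordinates: the first one is chosen from the projection, and the
others are chosen with it as a further parameter. -/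
theorem exists_defFun_tuple (n : ℕ) {ι : Type} [Finite ι] (p : (ι → M) → (Fin n → M) → Prop)
    (hp : DefPred L fun w : ι ⊕ Fin n → M => p (fun i => w (.inl i)) (fun k => w (.inr k))) :
    ∃ f : (ι → M) → Fin n → M, (∀ k, DefFun L fun v => f v k) ∧ ∀ v, (∃ y, p v y) → p v (f v) := by
  induction n generalizing ι with
  | zero => exact ⟨fun _ => Fin.elim0, fun k => k.elim0, fun v ⟨y, hy⟩ => by
      convert hy using 1⟩
  | succ n ih =>
    have hq : DefPred L fun w : Option ι ⊕ Fin n → M =>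
        p (fun i => w (.inl (some i))) (Fin.cons (w (.inl none)) fun k => w (.inr k)) :=
      hp.comp (g := fun w => Sum.elim (fun i => w (Sum.inl (some i)))
        (Fin.cons (w (Sum.inl none)) fun k => w (Sum.inr k) : Fin (n + 1) → M)) fun k => by
        rcases k with k | k
        · exact DefFun.var _
        · cases k using Fin.cases
          · exact DefFun.var _
          · exact DefFun.var _
    obtain ⟨f, hf, hf'⟩ := ih (fun (w : Option ι → M) y => p (fun i => w (some i))
      (Fin.cons (w none) y)) hq
    have : DefPred L fun w : Option ι → M => ∃ y, p (fun i => w (some i)) (Fin.cons (w none) y) :=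
      DefPred.exists_tuple (p := fun (w : Option ι → M) y => p (fun i => w (some i))
      (Fin.cons (w none) y)) hq
    obtain ⟨g, hg, hg'⟩ := exists_defFun (L := L) fun v x => ∃ y, p v (Fin.cons x y)
    have hvg : ∀ k : Option ι, DefFun L fun v => (k.elim (g v) v : M) := by
      rintro (_ | k)
      · exact hg
      · exact DefFun.var _
    refine ⟨fun v => Fin.cons (g v) (f fun o => o.elim (g v) v), fun k => ?_, fun v ⟨y, hy⟩ => ?_⟩
    · cases k using Fin.cases
      · exact hg
      · exact (hf _).comp hvg
    · refine hf' (fun o => o.elim (g v) v) (hg' v ⟨y 0, Fin.tail y, ?_⟩)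
      rwa [Fin.cons_self_tail]

end Choice

/-! ### Differential calculus over an ordered field -/

section Derivative

variable {M : Type*} [Field M] [LinearOrder M] [IsStrictOrderedRing M]

theorem HasOrderedFieldDerivAt.iff_sub {f : M → M} {d x : M} :
    HasOrderedFieldDerivAt f d x ↔ ∀ ε, 0 < ε → ∃ δ, 0 < δ ∧
      ∀ y, y ≠ x → |y - x| < δ → |(f y - f x) / (y - x) - d| < ε := by
  refine forall₂_congr fun ε _ => exists_congr fun δ => and_congr_right fun _ => ?_
  constructor
  · intro h y hy hyd
    simpa using h (y - x) (sub_ne_zero.2 hy) hyd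
  · intro h y hy hyd
    simpa using h (x + y) (by simpa using hy) (by simpa using hyd)

/-- Serves to glue two functions at a point where their values and derivatives agree. -/
theorem HasOrderedFieldDerivAt.of_sides {f g k : M → M} {d x : M}
    (hg : HasOrderedFieldDerivAt g d x) (hk : HasOrderedFieldDerivAt k d x)
    (hfg : ∀ y, x ≤ y → f y = g y) (hfk : ∀ y, y ≤ x → f y = k y) :
    HasOrderedFieldDerivAt f d x := by
  intro ε hε
  obtain ⟨δ₁, h₁, H₁⟩ := hg ε hε
  obtain ⟨δ₂, h₂, H₂⟩ := hk ε hε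
  refine ⟨min δ₁ δ₂, lt_min h₁ h₂, fun h h0 hh => ?_⟩
  rcases lt_or_gt_of_ne h0 with hn | hp
  · rw [hfk (x + h) (by linarith), hfk x le_rfl]
    exact H₂ h h0 (hh.trans_le (min_le_right _ _))
  · rw [hfg (x + h) (by linarith), hfg x le_rfl]
    exact H₁ h h0 (hh.trans_le (min_le_left _ _))

variable [TopologicalSpace M] [OrderTopology M]

theorem continuousAt_iff_abs {f : M → M} {x : M} :
    ContinuousAt f x ↔ ∀ ε, 0 < ε → ∃ δ, 0 < δ ∧ ∀ y, |y - x| < δ → |f y - f x| < ε :=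
  ((nhds_basis_abs_sub_lt x).tendsto_iff (nhds_basis_abs_sub_lt (f x)))

/-- Carathéodory's form of differentiability. -/
theorem hasOrderedFieldDerivAt_iff {f : M → M} {d x : M} :
    HasOrderedFieldDerivAt f d x ↔
      ∃ φ : M → M, ContinuousAt φ x ∧ φ x = d ∧ ∀ y, f y = f x + φ y * (y - x) := by
  rw [HasOrderedFieldDerivAt.iff_sub]
  constructor
  · intro h
    classical
    refine ⟨fun y => if y = x then d else (f y - f x) / (y - x), ?_, if_pos rfl, fun y => ?_⟩
    · rw [continuousAt_iff_abs]
      intro ε hε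
      obtain ⟨δ, hδ, H⟩ := h ε hε
      refine ⟨δ, hδ, fun y hy => ?_⟩
      by_cases hyx : y = x
      · simpa [hyx] using hε
      · simpa [hyx] using H y hyx hy
    · by_cases hyx : y = x
      · simp [hyx]
      · have := sub_ne_zero.2 hyx
        simp only [if_neg hyx]
        field_simp
        ring
  · rintro ⟨φ, hφ, rfl, h⟩ ε hε
    obtain ⟨δ, hδ, H⟩ := continuousAt_iff_abs.1 hφ ε hε
    refine ⟨δ, hδ, fun y hyx hy => ?_⟩
    have := sub_ne_zero.2 hyx
    have e : (f y - f x) / (y - x) = φ y := by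
      rw [h y]; field_simp; ring
    rw [e]
    exact H y hy

namespace HasOrderedFieldDerivAt

variable {f g : M → M} {d e x : M}

theorem continuousAt (h : HasOrderedFieldDerivAt f d x) : ContinuousAt f x := by
  obtain ⟨φ, hφ, -, H⟩ := hasOrderedFieldDerivAt_iff.1 h
  have : f = fun y => f x + φ y * (y - x) := funext H
  rw [this]
  fun_prop

theorem add (hf : HasOrderedFieldDerivAt f d x) (hg : HasOrderedFieldDerivAt g e x) :
    HasOrderedFieldDerivAt (fun y => f y + g y) (d + e) x := by
  obtain ⟨φ, hφ, rfl, H⟩ := hasOrderedFieldDerivAt_iff.1 hf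
  obtain ⟨ψ, hψ, rfl, K⟩ := hasOrderedFieldDerivAt_iff.1 hg
  refine hasOrderedFieldDerivAt_iff.2 ⟨fun y => φ y + ψ y, hφ.add hψ, rfl, fun y => ?_⟩
  rw [H y, K y]; ring

theorem neg (hf : HasOrderedFieldDerivAt f d x) :
    HasOrderedFieldDerivAt (fun y => - f y) (-d) x := by
  obtain ⟨φ, hφ, rfl, H⟩ := hasOrderedFieldDerivAt_iff.1 hf
  refine hasOrderedFieldDerivAt_iff.2 ⟨fun y => - φ y, hφ.neg, rfl, fun y => ?_⟩
  rw [H y]; ring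

theorem sub (hf : HasOrderedFieldDerivAt f d x) (hg : HasOrderedFieldDerivAt g e x) :
    HasOrderedFieldDerivAt (fun y => f y - g y) (d - e) x := by
  simpa only [sub_eq_add_neg] using hf.add hg.neg

theorem const (a x : M) : HasOrderedFieldDerivAt (fun _ => a) 0 x :=
  hasOrderedFieldDerivAt_iff.2 ⟨fun _ => 0, continuousAt_const, rfl, fun y => by ring⟩

theorem linear (a b x : M) : HasOrderedFieldDerivAt (fun y => a + b * y) b x :=
  hasOrderedFieldDerivAt_iff.2 ⟨fun _ => b, continuousAt_const, rfl, fun y => by ring⟩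

theorem comp (hg : HasOrderedFieldDerivAt g e (f x)) (hf : HasOrderedFieldDerivAt f d x) :
    HasOrderedFieldDerivAt (fun y => g (f y)) (e * d) x := by
  have hc := hf.continuousAt
  obtain ⟨φ, hφ, rfl, H⟩ := hasOrderedFieldDerivAt_iff.1 hf
  obtain ⟨ψ, hψ, rfl, K⟩ := hasOrderedFieldDerivAt_iff.1 hg
  refine hasOrderedFieldDerivAt_iff.2 ⟨fun y => ψ (f y) * φ y,
    (ContinuousAt.comp (f := f) hψ hc).mul hφ, rfl, fun y => ?_⟩
  rw [K (f y)]; linear_combination ψ (f y) * H y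

theorem unique (hf : HasOrderedFieldDerivAt f d x) (hg : HasOrderedFieldDerivAt f e x) :
    d = e := by
  by_contra hne
  have hε : 0 < |d - e| / 2 := half_pos (abs_pos.2 (sub_ne_zero.2 hne))
  obtain ⟨δ₁, h₁, H₁⟩ := hf _ hε
  obtain ⟨δ₂, h₂, H₂⟩ := hg _ hε
  obtain ⟨h, h0, hh⟩ := exists_between (lt_min h₁ h₂)
  have a1 := H₁ h h0.ne' (by rw [abs_of_pos h0]; exact hh.trans_le (min_le_left _ _))
  have a2 := H₂ h h0.ne' (by rw [abs_of_pos h0]; exact hh.trans_le (min_le_right _ _))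
  have := abs_sub_le d ((f (x + h) - f x) / h) e
  rw [abs_sub_comm d ((f (x + h) - f x) / h)] at this
  linarith

theorem congr_of_eventuallyEq (hf : HasOrderedFieldDerivAt f d x) (h : ∀ᶠ y in 𝓝 x, g y = f y) :
    HasOrderedFieldDerivAt g d x := by
  intro ε hε
  obtain ⟨δ, hδ, H⟩ := hf ε hε
  obtain ⟨δ', hδ', H'⟩ := (nhds_basis_abs_sub_lt x).eventually_iff.1 h
  refine ⟨min δ δ', lt_min hδ hδ', fun h h0 hh => ?_⟩
  rw [H' (x := x + h) (by simpa using hh.trans_le (min_le_right _ _)),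
    H' (x := x) (by simpa using hδ')]
  exact H h h0 (hh.trans_le (min_le_left _ _))

end HasOrderedFieldDerivAt

/-- `f` is differentiable at `x`, in the ordered field `M`. -/
def OFDiffAt (f : M → M) (x : M) : Prop := ∃ d, HasOrderedFieldDerivAt f d x

namespace OFDiffAt

variable {f g : M → M} {x : M}

theorem add (hf : OFDiffAt f x) (hg : OFDiffAt g x) : OFDiffAt (fun y => f y + g y) x :=
  ⟨_, hf.choose_spec.add hg.choose_spec⟩

theorem sub (hf : OFDiffAt f x) (hg : OFDiffAt g x) : OFDiffAt (fun y => f y - g y) x :=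
  ⟨_, hf.choose_spec.sub hg.choose_spec⟩

theorem neg (hf : OFDiffAt f x) : OFDiffAt (fun y => - f y) x := ⟨_, hf.choose_spec.neg⟩

theorem const (a x : M) : OFDiffAt (fun _ => a) x := ⟨_, .const a x⟩

theorem comp (hg : OFDiffAt g (f x)) (hf : OFDiffAt f x) : OFDiffAt (fun y => g (f y)) x :=
  ⟨_, hg.choose_spec.comp hf.choose_spec⟩

theorem congr_of_eventuallyEq (hf : OFDiffAt f x) (h : ∀ᶠ y in 𝓝 x, g y = f y) : OFDiffAt g x :=
  ⟨_, hf.choose_spec.congr_of_eventuallyEq h⟩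

end OFDiffAt

end Derivative

/-! ### Differentiability of definable functions somewhere on every interval -/

section GenericDifferentiability

variable {L : Language} {M : Type*} [Field M] [LinearOrder M] [L.Structure M]
  [hM : Fact (IsOMinimalExpansion L M)] [IsStrictOrderedRing M]

/-- The difference quotients of `f` from `x` to points slightly to the right exceed `r`. -/
def RightSlopeGT (f : M → M) (r x : M) : Prop :=
  ∃ δ, 0 < δ ∧ ∀ y, x < y → y < x + δ → r * (y - x) < f y - f x

/-- The difference quotients of `f` from `x` to points slightly to the left exceed `r`. -/
def LeftSlopeGT (f : M → M) (r x : M) : Prop :=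
  ∃ δ, 0 < δ ∧ ∀ y, x - δ < y → y < x → r * (x - y) < f x - f y

instance (f : M → M) [DefFun₁ L f] : DefPred₂ L (RightSlopeGT f) :=
  ⟨inferInstanceAs (DefPred L fun v : Fin 2 → M => ∃ δ, 0 < δ ∧
    ∀ y, v 1 < y → y < v 1 + δ → v 0 * (y - v 1) < f y - f (v 1))⟩

instance (f : M → M) [DefFun₁ L f] : DefPred₂ L (LeftSlopeGT f) :=
  ⟨inferInstanceAs (DefPred L fun v : Fin 2 → M => ∃ δ, 0 < δ ∧
    ∀ y, v 1 - δ < y → y < v 1 → v 0 * (v 1 - y) < f (v 1) - f y)⟩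

instance (f : M → M) [DefFun₁ L f] : DefFun₁ L fun x => - f x := ⟨inferInstance⟩

theorem RightSlopeGT.mono {f : M → M} {r s x : M} (h : RightSlopeGT f r x) (hs : s ≤ r) :
    RightSlopeGT f s x := by
  obtain ⟨δ, hδ, H⟩ := h
  refine ⟨δ, hδ, fun y h1 h2 => lt_of_le_of_lt ?_ (H y h1 h2)⟩
  exact mul_le_mul_of_nonneg_right hs (sub_nonneg.2 h1.le)

theorem LeftSlopeGT.mono {f : M → M} {r s x : M} (h : LeftSlopeGT f r x) (hs : s ≤ r) :
    LeftSlopeGT f s x := by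
  obtain ⟨δ, hδ, H⟩ := h
  refine ⟨δ, hδ, fun y h1 h2 => lt_of_le_of_lt ?_ (H y h1 h2)⟩
  exact mul_le_mul_of_nonneg_right hs (sub_nonneg.2 h2.le)

variable (L) in
-- By the dichotomy to the right of `x`, failure means that nearby slopes are at most `r`; the gap
-- `r < s` restores a strict inequality.
theorem rightSlopeGT_neg_of_not (f : M → M) [DefFun₁ L f] {r s x : M} (h : ¬ RightSlopeGT f r x)
    (hs : r < s) : RightSlopeGT (fun y => - f y) (-s) x := by
  let _ := Preorder.topology M
  have : OrderTopology M := ⟨rfl⟩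
  rcases (decidesConvex_nhdsGT x).eventually_or L (fun y => r * (y - x) < f y - f x) with h' | h'
  · obtain ⟨c, hc, -, H⟩ := exists_Ioo_of_eventually_nhdsGT (lt_add_one x) h'
    exact (h ⟨c - x, sub_pos.2 hc, fun y h1 h2 => H y ⟨h1, by linarith⟩⟩).elim
  · obtain ⟨c, hc, -, H⟩ := exists_Ioo_of_eventually_nhdsGT (lt_add_one x) h'
    refine ⟨c - x, sub_pos.2 hc, fun y h1 h2 => ?_⟩
    have := not_lt.1 (H y ⟨h1, by linarith⟩)
    have := mul_lt_mul_of_pos_right hs (sub_pos.2 h1)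
    linarith

variable (L) in
theorem leftSlopeGT_neg_of_not (f : M → M) [DefFun₁ L f] {r s x : M} (h : ¬ LeftSlopeGT f r x)
    (hs : r < s) : LeftSlopeGT (fun y => - f y) (-s) x := by
  let _ := Preorder.topology M
  have : OrderTopology M := ⟨rfl⟩
  rcases (decidesConvex_nhdsLT x).eventually_or L (fun y => r * (x - y) < f x - f y) with h' | h'
  · obtain ⟨c, -, hc, H⟩ := exists_Ioo_of_eventually_nhdsLT (sub_one_lt x) h'
    exact (h ⟨x - c, sub_pos.2 hc, fun y h1 h2 => H y ⟨by linarith, h2⟩⟩).elim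
  · obtain ⟨c, -, hc, H⟩ := exists_Ioo_of_eventually_nhdsLT (sub_one_lt x) h'
    refine ⟨x - c, sub_pos.2 hc, fun y h1 h2 => ?_⟩
    have := not_lt.1 (H y ⟨by linarith, h2⟩)
    have := mul_lt_mul_of_pos_right hs (sub_pos.2 h2)
    linarith

variable (L) in
-- A mean value inequality by continuous induction: at the supremum of the points reached so far,
-- the left slope shows that the supremum is itself reached, and the right slope passes beyond it
-- unless it is `y`.
theorem mul_sub_le_of_slopeGT (f : M → M) [DefFun₁ L f] {x y N : M} (hxy : x ≤ y)
    (hf : ∀ z, x ≤ z → z ≤ y → RightSlopeGT f N z ∧ LeftSlopeGT f N z) :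
    N * (y - x) ≤ f y - f x := by
  obtain ⟨s, hs⟩ := DefPred₁.exists_isLUB L (fun z => x ≤ z ∧ z ≤ y ∧ N * (z - x) ≤ f z - f x)
    ⟨x, le_rfl, hxy, by simp⟩ ⟨y, fun z hz => hz.2.1⟩
  have hxs : x ≤ s := hs.1 ⟨le_rfl, hxy, by simp⟩
  have hsy : s ≤ y := hs.2 fun z hz => hz.2.1
  have hmem : N * (s - x) ≤ f s - f x := by
    by_contra hn
    obtain ⟨δ, hδ, H⟩ := (hf s hxs hsy).2
    obtain ⟨z, hz, hδz⟩ := (lt_isLUB_iff hs).1 (sub_lt_self s hδ)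
    rcases (hs.1 hz).lt_or_eq with h | rfl
    · exact hn (by linarith [H z hδz h, hz.2.2])
    · exact hn hz.2.2
  rcases hsy.lt_or_eq with h | rfl
  · obtain ⟨δ, hδ, H⟩ := (hf s hxs hsy).1
    obtain ⟨z, hsz, hz⟩ := exists_between (lt_min h (lt_add_of_pos_right s hδ))
    have := H z hsz (hz.trans_le (min_le_right _ _))
    refine (hsz.not_ge (hs.1 ⟨hxs.trans hsz.le, hz.le.trans (min_le_left _ _), ?_⟩)).elim
    linarith
  · exact hmem

theorem not_holdsOnSubinterval_slope_infinite (f : M → M) [DefFun₁ L f] (a b : M) :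
    ¬ HoldsOnSubinterval a b fun x => ∀ N, RightSlopeGT f N x ∧ LeftSlopeGT f N x := by
  rintro ⟨a, b, -, hab, -, h⟩
  obtain ⟨x, hax, hxb⟩ := exists_between hab
  obtain ⟨y, hxy, hyb⟩ := exists_between hxb
  -- `N` exceeds the average slope between `x` and `y` by one.
  have := mul_sub_le_of_slopeGT L f (N := (f y - f x) / (y - x) + 1) hxy.le fun z h1 h2 =>
    h z ⟨hax.trans_le h1, h2.trans_lt hyb⟩ _
  have h0 := sub_pos.2 hxy
  rw [add_mul, div_mul_cancel₀ _ h0.ne'] at this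
  linarith

/-- Definable choice for a family of subsets of the line with one parameter. -/
theorem exists_defFun₁ (p : M → M → Prop) [hp : DefPred₂ L p] :
    ∃ f : M → M, DefFun₁ L f ∧ ∀ x, (∃ y, p x y) → p x (f x) := by
  obtain ⟨f, hf, h⟩ := exists_defFun (L := L) (ι := Fin 1) fun v y => p (v 0) y
  refine ⟨fun x => f fun _ => x, ⟨hf.comp fun _ => inferInstance⟩, fun x hx => h (fun _ => x) hx⟩

variable [TopologicalSpace M] [OrderTopology M]

variable (L) in
/-- A definable monotone condition that is satisfiable pointwise is satisfied uniformly on a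
subinterval. -/
theorem exists_uniform_on_subinterval {a b : M} (hab : a < b) (p : M → M → Prop) [DefPred₂ L p]
    (hmono : ∀ x N N', N ≤ N' → p x N → p x N') (h : ∀ x ∈ Ioo a b, ∃ N, p x N) :
    ∃ N, HoldsOnSubinterval a b fun x => p x N := by
  -- A definable choice of `N` depending on `x` is bounded on a subinterval, and monotonicity allows
  -- its bound to be used there.
  obtain ⟨γ, hγ, H⟩ := exists_defFun₁ (L := L) p
  obtain ⟨N, a', b', h1, h2, h3, hN⟩ := exists_abs_le_on_subinterval L hab γ
  exact ⟨N, a', b', h1, h2, h3, fun x hx => hmono x _ _ ((le_abs_self _).trans (hN x hx))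
    (H x (h x ⟨h1.trans_lt hx.1, hx.2.trans_le h3⟩))⟩

variable (L) in
/-- A definable function has small oscillation on some subinterval. -/
theorem exists_abs_sub_lt_on_subinterval {a b δ : M} (hab : a < b) (m : M → M) [DefFun₁ L m]
    (hδ : 0 < δ) : ∃ s, HoldsOnSubinterval a b fun x => |m x - s| < δ := by
  obtain ⟨B, a', b', h1, h2, h3, hB⟩ := exists_abs_le_on_subinterval L hab m
  -- `s` is the lower limit of `m` at `a'` from the right; by the dichotomy it is also an upper
  -- bound up to `δ / 2`.
  obtain ⟨s, hs⟩ := DefPred₁.exists_isLUB L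
    (fun r => ∃ t, a' < t ∧ ∀ x, a' < x → x < t → r < m x)
    ⟨-B - 1, b', h2, fun x hx hx' => by linarith [(abs_le.1 (hB x ⟨hx, hx'⟩)).1]⟩
    ⟨B, fun r ⟨t, ht, h⟩ => by
      obtain ⟨x, hx, hx'⟩ := exists_between (lt_min ht h2)
      exact (h x hx (hx'.trans_le (min_le_left _ _))).le.trans
        (abs_le.1 (hB x ⟨hx, hx'.trans_le (min_le_right _ _)⟩)).2⟩
  obtain ⟨r, ⟨t, ht, hr⟩, hrs⟩ := (lt_isLUB_iff hs).1 (sub_lt_self s hδ)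
  have hev : ∀ᶠ x in 𝓝[>] a', m x ≤ s + δ / 2 := by
    rcases (decidesConvex_nhdsGT a').eventually_or L (fun x => m x ≤ s + δ / 2) with h | h
    · exact h
    · obtain ⟨c, hc, -, H⟩ := exists_Ioo_of_eventually_nhdsGT h2 h
      have := hs.1 ⟨c, hc, fun x hx hx' => not_le.1 (H x ⟨hx, hx'⟩)⟩
      linarith
  obtain ⟨c, hc, hcb, H⟩ := exists_Ioo_of_eventually_nhdsGT h2 hev
  refine ⟨s, a', min c t, h1, lt_min hc ht, (min_le_left _ _).trans (hcb.trans h3),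
    fun x hx => abs_lt.2 ⟨?_, ?_⟩⟩
  · linarith [hr x hx.1 (hx.2.trans_le (min_le_right _ _))]
  · linarith [H x ⟨hx.1, hx.2.trans_le (min_le_left _ _)⟩]

/-- The right slopes of `f` at `x` exceed the left slopes. -/
def ConvexCorner (f : M → M) (x : M) : Prop :=
  ∃ r δ, 0 < δ ∧ RightSlopeGT f (r + δ) x ∧ LeftSlopeGT (fun y => - f y) (-(r - δ)) x

/-- After shrinking the interval, a single number `s` separates left from right slopes at every
point, on a uniform scale. For two close points `x < y`, the chord then has slope above `s` as seen
from `x` and below `s` as seen from `y`. -/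
theorem not_holdsOnSubinterval_convexCorner (f : M → M) [DefFun₁ L f] (a b : M) :
    ¬ HoldsOnSubinterval a b (ConvexCorner f) := by
  rintro ⟨a, b, -, hab, -, h⟩
  obtain ⟨m, hm, H⟩ := exists_defFun₁ (L := L) fun x r => ∃ δ, 0 < δ ∧
    RightSlopeGT f (r + δ) x ∧ LeftSlopeGT (fun y => - f y) (-(r - δ)) x
  have : DefPred₂ L fun x N => 0 < N ∧ RightSlopeGT f (m x + 1 / N) x ∧
      LeftSlopeGT (fun y => - f y) (-(m x - 1 / N)) x := ⟨inferInstance⟩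
  -- The half-width of the corner is written `1 / N`, so that the condition is monotone in `N` and
  -- can be made uniform; likewise `1 / K` below for the size of the neighbourhood.
  obtain ⟨N, a₁, b₁, h1, hab₁, h3, hN⟩ := exists_uniform_on_subinterval L hab (fun x N => 0 < N ∧
    RightSlopeGT f (m x + 1 / N) x ∧ LeftSlopeGT (fun y => - f y) (-(m x - 1 / N)) x)
    (fun x N N' hNN ⟨h0, hR, hL⟩ => by
      have := one_div_le_one_div_of_le h0 hNN
      exact ⟨h0.trans_le hNN, hR.mono (by linarith), hL.mono (by linarith)⟩)
    (fun x hx => by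
      obtain ⟨δ, hδ, hR, hL⟩ := H x (h x hx)
      exact ⟨1 / δ, by positivity, by simpa using hR, by simpa using hL⟩)
  obtain ⟨z, hz⟩ := exists_between hab₁
  have hδ : 0 < 1 / N := one_div_pos.2 (hN z hz).1
  -- The separating value `m` varies from `s` by less than the uniform half-width, so `s` itself
  -- separates the slopes.
  obtain ⟨s, a₂, b₂, h4, hab₂, h6, hs⟩ := exists_abs_sub_lt_on_subinterval L hab₁ m hδ
  have hsl : ∀ x ∈ Ioo a₂ b₂, ∃ K, 0 < K ∧ ∀ y, |y - x| * K < 1 →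
      (x < y → s * (y - x) < f y - f x) ∧ (y < x → -s * (x - y) < - f x - - f y) := by
    intro x hx
    have hx' := abs_lt.1 (hs x hx)
    obtain ⟨-, hR, hL⟩ := hN x ⟨h4.trans_lt hx.1, hx.2.trans_le h6⟩
    obtain ⟨δ₁, hδ₁, H₁⟩ := hR.mono (show s ≤ _ by linarith)
    obtain ⟨δ₂, hδ₂, H₂⟩ := hL.mono (show -s ≤ _ by linarith)
    have h0 := lt_min hδ₁ hδ₂
    refine ⟨1 / min δ₁ δ₂, one_div_pos.2 h0, fun y hy => ?_⟩
    rw [mul_one_div, div_lt_one h0, lt_min_iff] at hy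
    exact ⟨fun hxy => H₁ y hxy (by linarith [(abs_lt.1 hy.1).2]),
      fun hxy => H₂ y (by linarith [(abs_lt.1 hy.2).1]) hxy⟩
  have : DefPred₂ L fun x K => 0 < K ∧ ∀ y, |y - x| * K < 1 →
      (x < y → s * (y - x) < f y - f x) ∧ (y < x → -s * (x - y) < - f x - - f y) := ⟨inferInstance⟩
  obtain ⟨K, a₃, b₃, -, hab₃, -, hK⟩ := exists_uniform_on_subinterval L hab₂ (fun x K => 0 < K ∧
    ∀ y, |y - x| * K < 1 →
      (x < y → s * (y - x) < f y - f x) ∧ (y < x → -s * (x - y) < - f x - - f y))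
    (fun x N N' hNN ⟨h0, h⟩ => ⟨h0.trans_le hNN, fun y hy => h y
      ((mul_le_mul_of_nonneg_left hNN (abs_nonneg _)).trans_lt hy)⟩) hsl
  obtain ⟨x, hx⟩ := exists_between hab₃
  have hK0 := (hK x hx).1
  obtain ⟨y, hxy, hy⟩ := exists_between (lt_min hx.2 (lt_add_of_pos_right x (one_div_pos.2 hK0)))
  have hyx : |y - x| * K < 1 := by
    rw [abs_of_pos (sub_pos.2 hxy), ← lt_div_iff₀ hK0]
    linarith [hy.trans_le (min_le_right _ _)]
  have e1 := ((hK x hx).2 y hyx).1 hxy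
  have e2 := ((hK y ⟨hx.1.trans hxy, hy.trans_le (min_le_left _ _)⟩).2 x
    (by rwa [abs_sub_comm])).2 hxy
  linarith

theorem HasOrderedFieldDerivAt.of_slopes {f : M → M} {d x : M}
    (hR : ∀ r < d, RightSlopeGT f r x) (hL : ∀ r < d, LeftSlopeGT f r x)
    (hR' : ∀ r > d, RightSlopeGT (fun y => - f y) (-r) x)
    (hL' : ∀ r > d, LeftSlopeGT (fun y => - f y) (-r) x) : HasOrderedFieldDerivAt f d x := by
  rw [HasOrderedFieldDerivAt.iff_sub]
  intro ε hε
  obtain ⟨δ₁, h₁, H₁⟩ := hR (d - ε) (by linarith)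
  obtain ⟨δ₂, h₂, H₂⟩ := hL (d - ε) (by linarith)
  obtain ⟨δ₃, h₃, H₃⟩ := hR' (d + ε) (by linarith)
  obtain ⟨δ₄, h₄, H₄⟩ := hL' (d + ε) (by linarith)
  refine ⟨min (min δ₁ δ₂) (min δ₃ δ₄), by positivity, fun y hyx hy => ?_⟩
  simp only [lt_min_iff] at hy
  obtain ⟨⟨g1, g2⟩, g3, g4⟩ := hy
  rw [abs_lt] at *
  rcases lt_or_gt_of_ne hyx with h | h
  · have e1 := H₂ y (by linarith) h
    have e2 := H₄ y (by linarith) h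
    have h0 := sub_pos.2 h
    have : (f y - f x) / (y - x) = (f x - f y) / (x - y) := by
      rw [← neg_sub (f x), ← neg_sub x, neg_div_neg_eq]
    rw [this, lt_sub_iff_add_lt, sub_lt_iff_lt_add, lt_div_iff₀ h0, div_lt_iff₀ h0]
    constructor <;> linarith
  · have e1 := H₁ y h (by linarith)
    have e2 := H₃ y h (by linarith)
    have h0 := sub_pos.2 h
    rw [lt_sub_iff_add_lt, sub_lt_iff_lt_add, lt_div_iff₀ h0, div_lt_iff₀ h0]
    constructor <;> linarith

variable (L) in
-- Without corners, the right and left slopes have the same threshold value. If it is finite, it is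
-- the derivative; otherwise both slopes are infinite with the same sign.
theorem slope_trichotomy (f : M → M) [DefFun₁ L f] {x : M} (hx : ¬ OFDiffAt f x) :
    ConvexCorner f x ∨ ConvexCorner (fun y => - f y) x ∨
      (∀ N, RightSlopeGT f N x ∧ LeftSlopeGT f N x) ∨
      (∀ N, RightSlopeGT (fun y => - f y) N x ∧ LeftSlopeGT (fun y => - f y) N x) := by
  by_contra! hcon
  obtain ⟨hA, hB, ⟨N, hC⟩, N', hD⟩ := hcon
  have hRL : ∀ r s, s < r → RightSlopeGT f r x → LeftSlopeGT f s x := by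
    intro r s hrs hr
    by_contra hs
    refine hA ⟨(r + s) / 2, (r - s) / 4, by linarith, hr.mono (by linarith),
      leftSlopeGT_neg_of_not L f hs (by linarith)⟩
  have hLR : ∀ r s, s < r → LeftSlopeGT f r x → RightSlopeGT f s x := by
    intro r s hrs hr
    by_contra hs
    refine hB ⟨-(r + s) / 2, (r - s) / 4, by linarith,
      (rightSlopeGT_neg_of_not L f hs (s := (r + s) / 2 - (r - s) / 4) (by linarith)).mono
        (by linarith), ?_⟩
    simp only [neg_neg]
    exact hr.mono (by linarith)
  have hne : ∃ r, RightSlopeGT f r x := by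
    by_contra! h
    refine hD ?_ ?_
    · simpa using rightSlopeGT_neg_of_not L f (h (-N' - 1)) (sub_one_lt _)
    · simpa using leftSlopeGT_neg_of_not L f (fun h' =>
        h (-N' - 2) (hLR (-N' - 1) _ (by linarith) h'))
        (sub_one_lt _)
  have hbd : ∃ r, ¬ RightSlopeGT f r x := by
    by_contra! h
    exact hC (h N) (hRL (N + 1) N (lt_add_one N) (h _))
  obtain ⟨u, hu⟩ := hbd
  -- The candidate derivative is the supremum of the numbers exceeded by the right slopes.
  obtain ⟨d, hd⟩ := DefPred₁.exists_isLUB L (fun r => RightSlopeGT f r x) hne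
    ⟨u, fun r hr => le_of_not_gt fun h => hu (RightSlopeGT.mono hr h.le)⟩
  have h1 : ∀ r < d, RightSlopeGT f r x := fun r hr => by
    obtain ⟨s, hs, hrs⟩ := (lt_isLUB_iff hd).1 hr
    exact RightSlopeGT.mono hs hrs.le
  have h2 : ∀ r > d, ¬ RightSlopeGT f r x := fun r hr h => hr.not_ge (hd.1 h)
  refine hx ⟨d, .of_slopes h1 (fun r hr => ?_) (fun r hr => ?_) fun r hr => ?_⟩
  · obtain ⟨s, hrs, hs⟩ := exists_between hr
    exact hRL s r hrs (h1 s hs)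
  · obtain ⟨s, hs, hrs⟩ := exists_between hr
    exact rightSlopeGT_neg_of_not L f (h2 s hs) hrs
  · obtain ⟨s, hs, hrs⟩ := exists_between hr
    obtain ⟨t, ht, hts⟩ := exists_between hs
    exact leftSlopeGT_neg_of_not L f (fun h => h2 t ht (hLR s t hts h)) hrs

variable (L) in
/-- A definable function of one variable is differentiable somewhere on each interval. -/
theorem exists_ofDiffAt {a b : M} (hab : a < b) (f : M → M) [DefFun₁ L f] :
    ∃ x ∈ Ioo a b, OFDiffAt f x := by
  by_contra! h
  have i1 : DefPred₁ L (ConvexCorner f) := ⟨inferInstanceAs (DefPred L fun v : Fin 1 → M => ∃ r δ,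
    0 < δ ∧ RightSlopeGT f (r + δ) (v 0) ∧ LeftSlopeGT (fun y => - f y) (-(r - δ)) (v 0))⟩
  have i2 : DefPred₁ L (ConvexCorner fun y => - f y) :=
    ⟨inferInstanceAs (DefPred L fun v : Fin 1 → M => ∃ r δ, 0 < δ ∧
    RightSlopeGT (fun y => - f y) (r + δ) (v 0) ∧ LeftSlopeGT (fun y => - - f y) (-(r - δ)) (v 0))⟩
  rcases HoldsOnSubinterval.of_or L hab fun x hx => slope_trichotomy L f (h x hx) with h1 | h1
  · exact not_holdsOnSubinterval_convexCorner (L := L) f a b h1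
  obtain ⟨a, b, -, hab, -, h1⟩ := h1
  rcases HoldsOnSubinterval.of_or L hab h1 with h1 | h1
  · exact not_holdsOnSubinterval_convexCorner (L := L) _ a b h1
  obtain ⟨a, b, -, hab, -, h1⟩ := h1
  rcases HoldsOnSubinterval.of_or L hab h1 with h1 | h1
  · exact not_holdsOnSubinterval_slope_infinite (L := L) _ a b h1
  · exact not_holdsOnSubinterval_slope_infinite (L := L) _ a b h1

theorem HasOrderedFieldDerivAt.slopes {f : M → M} {d r x : M} (h : HasOrderedFieldDerivAt f d x)
    (hr : r < d) : RightSlopeGT f r x ∧ LeftSlopeGT f r x := by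
  obtain ⟨δ, hδ, H⟩ := HasOrderedFieldDerivAt.iff_sub.1 h (d - r) (sub_pos.2 hr)
  refine ⟨⟨δ, hδ, fun y h1 h2 => ?_⟩, ⟨δ, hδ, fun y h1 h2 => ?_⟩⟩
  · have h0 := sub_pos.2 h1
    have := (abs_lt.1 (H y h1.ne' (by rw [abs_of_pos h0]; linarith))).1
    rw [← lt_div_iff₀ h0]; linarith
  · have h0 := sub_pos.2 h2
    have := (abs_lt.1 (H y h2.ne (by rw [abs_sub_comm, abs_of_pos h0]; linarith))).1
    have e : (f y - f x) / (y - x) = (f x - f y) / (x - y) := by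
      rw [← neg_sub (f x), ← neg_sub x, neg_div_neg_eq]
    rw [← lt_div_iff₀ h0, ← e]; linarith

variable (L) in
theorem le_of_hasDeriv_zero (f : M → M) [DefFun₁ L f]
    (h : ∀ x, HasOrderedFieldDerivAt f 0 x) {x y : M} (hxy : x < y) : f x ≤ f y := by
  by_contra! hlt
  have h0 := sub_pos.2 hxy
  -- Half of the negative average slope is below the derivative `0`, yet above the average slope.
  have := mul_sub_le_of_slopeGT L f (N := (f y - f x) / (2 * (y - x))) hxy.le fun z _ _ =>
    (h z).slopes (div_neg_of_neg_of_pos (by linarith) (by linarith))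
  have e : (f y - f x) / (2 * (y - x)) * (y - x) = (f y - f x) / 2 := by field_simp
  rw [e] at this
  linarith

variable (L) in
/-- A definable function with derivative zero everywhere is constant. -/
theorem eq_of_hasDeriv_zero (f : M → M) [DefFun₁ L f]
    (h : ∀ x, HasOrderedFieldDerivAt f 0 x) (x y : M) : f x = f y := by
  have key : ∀ x y, x < y → f x = f y := fun x y hxy =>
    le_antisymm (le_of_hasDeriv_zero L f h hxy) (neg_le_neg_iff.1
      (le_of_hasDeriv_zero L (fun x => - f x) (fun x => by simpa using (h x).neg) hxy))
  rcases lt_trichotomy x y with hxy | rfl | hxy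
  · exact key x y hxy
  · rfl
  · exact (key y x hxy).symm

end GenericDifferentiability

/-! ### Definable maps between types with coordinates -/

section DefinableMaps

variable {L : Language} {M : Type*} [L.Structure M] {ι κ : Type}
  {T S R : Type*} [Coordinates M T] [Coordinates M S] [Coordinates M R]

theorem DefPred.forall_finite [Finite κ] {p : κ → (ι → M) → Prop} (hp : ∀ k, DefPred L (p k)) :
    DefPred L fun v => ∀ k, p k v := by
  have h := Set.definable_iInter_of_finite fun k => (hp k).out
  refine ⟨?_⟩
  convert! h using 1
  ext v
  simp

theorem DefFun.graph {f : (ι → M) → M} (hf : DefFun L f) :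
    DefPred L fun w : Option ι → M => w none = f fun i => w (some i) := by
  have h := hf.out
  unfold Set.DefinableFun at h
  refine ⟨?_⟩
  convert! h using 1
  ext w
  simp [Function.tupleGraph, Function.comp_def, eq_comm]

theorem DefFun.reindex (e : ι → κ) {f : (ι → M) → M} (hf : DefFun L f) :
    DefFun L fun v : κ → M => f fun i => v (e i) :=
  .of_graph (hf.graph.reindex (Option.map e))

variable (L) in
/-- A map from tuples to a type with coordinates is definable if its coordinates are. -/
def DefMap (F : (ι → M) → T) : Prop :=
  ∀ k, DefFun L fun v => Coordinates.coord (M := M) (F v) k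

instance : Finite (Coordinates.Index M M) := inferInstanceAs (Finite Unit)

instance {n : ℕ} (U : Set (Fin n → M)) : Finite (Coordinates.Index M U) :=
  inferInstanceAs (Finite (Fin n))

instance [Finite (Coordinates.Index M T)] [Finite (Coordinates.Index M S)] :
    Finite (Coordinates.Index M (T × S)) :=
  inferInstanceAs (Finite (Coordinates.Index M T ⊕ Coordinates.Index M S))

theorem DefFun.defMap {f : (ι → M) → M} (h : DefFun L f) : DefMap L f := fun _ => h

theorem DefMap.defFun {f : (ι → M) → M} (h : DefMap L f) : DefFun L f := h ()

theorem DefMap.prodMk {F : (ι → M) → T} {G : (ι → M) → S} (hF : DefMap L F) (hG : DefMap L G) :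
    DefMap L fun v => (F v, G v) := by
  rintro (k | k)
  · exact hF k
  · exact hG k

theorem DefMap.eq [Finite (Coordinates.Index M T)] {F G : (ι → M) → T} (hF : DefMap L F)
    (hG : DefMap L G) : DefPred L fun v => F v = G v := by
  refine (DefPred.forall_finite fun k => @DefPred.eq L M _ ι _ _ (hF k) (hG k)).congr fun v => ?_
  exact ⟨fun h => Coordinates.coord_injective (M := M) (funext h), fun h k => by rw [h]⟩

/-- A coordinate of `f (F v)` is described by quantifying over a tuple `u` with `(F v, u)` in the
graph of `f`; this is allowed because there are finitely many coordinates. -/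
theorem IsDefinableMap.comp_defMap [Finite (Coordinates.Index M T)] [Finite (Coordinates.Index M S)]
    {f : T → S} (hf : IsDefinableMap L M f) {F : (ι → M) → T} (hF : DefMap L F) :
    DefMap L fun v => f (F v) := by
  intro k
  refine .of_graph ?_
  have h1 : DefPred L fun w : Option ι ⊕ Coordinates.Index M S → M =>
      (Sum.elim (Coordinates.coord (M := M) (F fun i => w (.inl (some i)))) (fun k => w (.inr k))) ∈
        range fun t : T => Sum.elim (Coordinates.coord (M := M) t)
          (Coordinates.coord (M := M) (f t)) := by
    refine DefPred.comp (p := fun w => w ∈ range fun t : T =>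
      Sum.elim (Coordinates.coord (M := M) t) (Coordinates.coord (M := M) (f t))) ⟨hf⟩
      (g := fun w : Option ι ⊕ Coordinates.Index M S → M =>
        Sum.elim (Coordinates.coord (M := M) (F fun i => w (.inl (some i)))) (fun k => w (.inr k)))
      fun k => ?_
    rcases k with k | k
    · exact (hF k).reindex _
    · exact DefFun.var _
  have h2 : DefPred L fun w : Option ι ⊕ Coordinates.Index M S → M =>
    w (.inl none) = w (.inr k) := inferInstance
  refine (DefPred.exists_tuple (p := fun (w : Option ι → M) (u : Coordinates.Index M S → M) =>
    Sum.elim (Coordinates.coord (M := M) (F fun i => w (some i))) u ∈ (range fun t : T =>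
      Sum.elim (Coordinates.coord (M := M) t) (Coordinates.coord (M := M) (f t))) ∧ w none = u k)
    (@DefPred.and L M _ _ _ _ h1 h2)).congr fun w => ?_
  constructor
  · rintro ⟨u, ⟨t, ht⟩, hu⟩
    have e1 : t = F fun i => w (some i) :=
      Coordinates.coord_injective (M := M) (funext fun k => congrFun ht (.inl k))
    beta_reduce
    rw [hu, ← e1]
    exact (congrFun ht (.inr k)).symm
  · intro h
    exact ⟨Coordinates.coord (M := M) (f (F fun i => w (some i))), ⟨_, rfl⟩, h⟩

theorem IsDefinableMap.of_defMap [Finite (Coordinates.Index M S)] {f : M → S}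
    (h : DefMap L fun v : Fin 1 → M => f (v 0)) : IsDefinableMap L M f := by
  have : DefPred L fun w : Unit ⊕ Coordinates.Index M S → M =>
      ∀ k, w (.inr k) = Coordinates.coord (M := M) (f (w (.inl ()))) k := by
    refine DefPred.forall_finite fun k => ?_
    have := (h k).reindex (κ := Unit ⊕ Coordinates.Index M S) fun _ => .inl ()
    infer_instance
  refine (this.congr fun w => ?_).out
  constructor
  · refine fun hw => ⟨w (.inl ()), funext fun k => ?_⟩
    rcases k with k | k
    · rfl
    · exact (hw k).symm
  · rintro ⟨t, rfl⟩ k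
    rfl

theorem IsDefinableMap.of_defMap₂ [Finite (Coordinates.Index M S)] {f : M × M → S}
    (h : DefMap L fun v : Fin 2 → M => f (v 0, v 1)) : IsDefinableMap L M f := by
  have : DefPred L fun w : (Unit ⊕ Unit) ⊕ Coordinates.Index M S → M =>
      ∀ k, w (.inr k) = Coordinates.coord (M := M)
        (f (w (.inl (.inl ())), w (.inl (.inr ())))) k := by
    refine DefPred.forall_finite fun k => ?_
    have := (h k).reindex (κ := (Unit ⊕ Unit) ⊕ Coordinates.Index M S)
      ![.inl (.inl ()), .inl (.inr ())]
    exact DefPred.eq (hg := this)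
  refine (this.congr fun w => ?_).out
  constructor
  · refine fun hw => ⟨(w (.inl (.inl ())), w (.inl (.inr ()))), funext fun k => ?_⟩
    rcases k with (k | k) | k
    · rfl
    · rfl
    · exact (hw k).symm
  · rintro ⟨t, rfl⟩ k
    rfl

theorem IsDefinableMap.symm {f : T ≃ S} (h : IsDefinableMap L M (fun t => f t)) :
    IsDefinableMap L M (fun s => f.symm s) := by
  have := DefPred.reindex (L := L) (Sum.swap : Coordinates.Index M T ⊕ Coordinates.Index M S →
    Coordinates.Index M S ⊕ Coordinates.Index M T) ⟨h⟩
  refine (this.congr fun w => ?_).out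
  constructor
  · rintro ⟨t, ht⟩
    refine ⟨f t, funext fun k => ?_⟩
    rcases k with k | k
    · exact congrFun ht (.inr k)
    · simpa using congrFun ht (.inl k)
  · rintro ⟨t, ht⟩
    refine ⟨f.symm t, funext fun k => ?_⟩
    rcases k with k | k
    · exact congrFun ht (.inr k)
    · simpa using congrFun ht (.inl k)

end DefinableMaps

/-! ### Definable subgroups and homomorphisms of ordered groups on the line -/

section OrderedGroups

variable {L : Language} {M : Type*} [Field M] [LinearOrder M] [L.Structure M]
  [hM : Fact (IsOMinimalExpansion L M)] [IsStrictOrderedRing M] {op : M → M → M}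

theorem IsOMinimalExpansion.isDefinableOrderedGroup_add (hM : IsOMinimalExpansion L M) :
    IsDefinableOrderedGroup L fun x y : M => x + y where
  definable := hM.add_definable
  assoc := add_assoc
  zero_op := zero_add
  op_zero := add_zero
  exists_inverse x := ⟨-x, add_neg_cancel x, neg_add_cancel x⟩
  strictMono_left z := fun _ _ h => add_lt_add_left h z
  strictMono_right z := fun _ _ h => add_lt_add_right h z

namespace IsDefinableOrderedGroup

theorem defFun₂ (hop : IsDefinableOrderedGroup L op) : DefFun₂ L op :=
  .of_isDefinableMap hop.definable

/-- The inverse in the ordered group. -/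
noncomputable def inv (hop : IsDefinableOrderedGroup L op) (x : M) : M :=
  (hop.exists_inverse x).choose

theorem op_inv (hop : IsDefinableOrderedGroup L op) (x : M) : op x (hop.inv x) = 0 :=
  (hop.exists_inverse x).choose_spec.1

theorem inv_op (hop : IsDefinableOrderedGroup L op) (x : M) : op (hop.inv x) x = 0 :=
  (hop.exists_inverse x).choose_spec.2

theorem op_inv_op (hop : IsDefinableOrderedGroup L op) (x y : M) : op x (op (hop.inv x) y) = y := by
  rw [← hop.assoc, hop.op_inv, hop.zero_op]

theorem inv_op_op (hop : IsDefinableOrderedGroup L op) (x y : M) : op (hop.inv x) (op x y) = y := by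
  rw [← hop.assoc, hop.inv_op, hop.zero_op]

theorem op_op_inv (hop : IsDefinableOrderedGroup L op) (x y : M) : op (op x y) (hop.inv y) = x := by
  rw [hop.assoc, hop.op_inv, hop.op_zero]

theorem op_inv_op' (hop : IsDefinableOrderedGroup L op) (x y : M) :
    op (op x (hop.inv y)) y = x := by
  rw [hop.assoc, hop.inv_op, hop.op_zero]

theorem lt_iff_left (hop : IsDefinableOrderedGroup L op) {x y : M} (z : M) :
    op x z < op y z ↔ x < y := (hop.strictMono_left z).lt_iff_lt

theorem lt_iff_right (hop : IsDefinableOrderedGroup L op) {x y : M} (z : M) :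
    op z x < op z y ↔ x < y := (hop.strictMono_right z).lt_iff_lt

theorem inv_pos (hop : IsDefinableOrderedGroup L op) {x : M} (hx : x < 0) : 0 < hop.inv x := by
  rw [← hop.lt_iff_right x, hop.op_zero, hop.op_inv]
  exact hx

/-- A definable subgroup of a definable ordered group on the line is trivial or everything. -/
theorem forall_of_subgroup (hop : IsDefinableOrderedGroup L op) (p : M → Prop) [DefPred₁ L p]
    (h0 : p 0) (hmul : ∀ x y, p x → p y → p (op x y)) (hinv : ∀ x, p x → p (hop.inv x))
    {x : M} (hx : p x) (hx0 : x ≠ 0) (y : M) : p y := by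
  obtain ⟨z, hz, hz0⟩ : ∃ z, p z ∧ 0 < z := by
    rcases lt_or_gt_of_ne hx0 with h | h
    · exact ⟨_, hinv x hx, hop.inv_pos h⟩
    · exact ⟨x, hx, h⟩
  -- If the subgroup contains all large elements, then every `y` is a quotient of two of them.
  rcases decidesConvex_atTop.eventually_or L p with h | h
  · obtain ⟨t, ht⟩ := eventually_atTop.1 h
    set w := max t (op (hop.inv y) t)
    have h1 : p w := ht _ (le_max_left _ _)
    have h2 : p (op y w) := by
      refine ht _ ?_
      rw [← hop.op_inv_op y t]
      exact (hop.strictMono_right y).monotone (le_max_right _ _)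
    rw [← hop.op_op_inv y w]
    exact hmul _ _ h2 (hinv _ h1)
  · obtain ⟨t, ht⟩ := eventually_atTop.1 h
    obtain ⟨s, hs⟩ := DefPred₁.exists_isLUB L p ⟨0, h0⟩
      ⟨t, fun x hx => le_of_not_ge fun h => ht x h hx⟩
    -- Otherwise the subgroup has a supremum `s`, and translating an element close to `s` by the
    -- positive element `z` of the subgroup goes past it.
    have hlt : op (hop.inv z) s < s := by
      rw [← hop.lt_iff_right z, hop.op_inv_op]
      conv_lhs => rw [← hop.zero_op s]
      exact (hop.lt_iff_left s).2 hz0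
    obtain ⟨u, hu, hsu⟩ := (lt_isLUB_iff hs).1 hlt
    have := hs.1 (hmul z u hz hu)
    rw [← hop.lt_iff_right z, hop.op_inv_op] at hsu
    exact absurd this hsu.not_ge

/-- A nontrivial definable homomorphism between definable ordered groups on the line is
bijective. -/
theorem bijective_of_hom {op₁ : M → M → M} (h₁ : IsDefinableOrderedGroup L op₁)
    (hop : IsDefinableOrderedGroup L op) (ψ : M → M) [DefFun₁ L ψ]
    (hψ : ∀ x y, ψ (op₁ x y) = op (ψ x) (ψ y)) {x : M} (hx : ψ x ≠ 0) : Function.Bijective ψ := by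
  have hψ0 : ψ 0 = 0 := by
    have := hψ 0 0
    rw [h₁.zero_op] at this
    have e := hop.inv_op_op (ψ 0) (ψ 0)
    rw [← this, hop.inv_op] at e
    exact e.symm
  have hψinv : ∀ x, ψ (h₁.inv x) = hop.inv (ψ x) := fun x => by
    have := hψ x (h₁.inv x)
    rw [h₁.op_inv, hψ0] at this
    rw [← hop.inv_op_op (ψ x) (ψ (h₁.inv x)), ← this, hop.op_zero]
  -- The kernel is a definable subgroup that omits `x`, hence trivial; the image is a nontrivial
  -- definable subgroup, hence everything.
  have hker : ∀ y, ψ y = 0 → y = 0 := by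
    intro y hy
    by_contra hy0
    refine hx (h₁.forall_of_subgroup (fun y => ψ y = 0) hψ0 (fun a b ha hb => ?_) (fun a ha => ?_)
      hy hy0 x)
    · rw [hψ, ha, hb, hop.zero_op]
    · rw [hψinv, ha, ← hop.zero_op (hop.inv 0), hop.op_inv]
  refine ⟨fun a b hab => ?_, fun y => ?_⟩
  · have : ψ (op₁ a (h₁.inv b)) = 0 := by rw [hψ, hψinv, hab, hop.op_inv]
    rw [← h₁.op_inv_op' a b, hker _ this, h₁.zero_op]
  · refine hop.forall_of_subgroup (fun y => ∃ x, ψ x = y) ⟨0, hψ0⟩ ?_ ?_ ⟨x, rfl⟩ hx y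
    · rintro _ _ ⟨a, rfl⟩ ⟨b, rfl⟩
      exact ⟨_, hψ a b⟩
    · rintro _ ⟨a, rfl⟩
      exact ⟨_, hψinv a⟩

end IsDefinableOrderedGroup

end OrderedGroups

/-! ### Smoothing of symmetric cocycles and the differential equation -/

section Cocycles

variable {L : Language} {M : Type*} [Field M] [LinearOrder M] [L.Structure M]
  [hM : Fact (IsOMinimalExpansion L M)] [IsStrictOrderedRing M] {op : M → M → M}

instance DefPred.ofDiffAt {c : M → M → M} [hc : DefFun₂ L c] {ι : Type} {f g : (ι → M) → M}
    [DefFun L f] [DefFun L g] : DefPred L fun v => OFDiffAt (fun y => c y (g v)) (f v) :=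
  have : DefPred₂ L fun x k => OFDiffAt (fun y => c y k) x :=
    ⟨inferInstanceAs (DefPred L fun v : Fin 2 → M => ∃ d, ∀ ε, 0 < ε → ∃ δ, 0 < δ ∧
      ∀ h, h ≠ 0 → |h| < δ → |(c (v 0 + h) (v 1) - c (v 0) (v 1)) / h - d| < ε)⟩
  DefPred₂.comp (p := fun x k => OFDiffAt (fun y => c y k) x)

variable [TopologicalSpace M] [OrderTopology M]

variable (L) in
theorem eventually_ofDiffAt (c : M → M → M) [DefFun₂ L c] (k : M) :
    ∀ᶠ x in atTop, OFDiffAt (fun y => c y k) x := by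
  refine (decidesConvex_atTop.eventually_or L _).resolve_right fun h => ?_
  obtain ⟨t, ht⟩ := eventually_atTop.1 h
  have : DefFun₁ L fun y => c y k := ⟨inferInstance⟩
  obtain ⟨x, hx, hd⟩ := exists_ofDiffAt L (lt_add_one t) fun y => c y k
  exact ht x hx.1.le hd

variable (L) in
-- The bound `N` can be made uniform on a subinterval, where `c(·, N)` would then be nowhere
-- differentiable.
theorem not_holds_not_ofDiffAt (c : M → M → M) [DefFun₂ L c] {a b : M} (hab : a < b)
    (h : ∀ x ∈ Ioo a b, ∃ N, ∀ g, N ≤ g → ¬ OFDiffAt (fun y => c y g) x) : False := by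
  obtain ⟨N, a', b', -, hab', -, H⟩ := exists_uniform_on_subinterval L hab
    (fun x N => ∀ g, N ≤ g → ¬ OFDiffAt (fun y => c y g) x)
    (fun x N N' hN h g hg => h g (hN.trans hg)) h
  have : DefFun₁ L fun y => c y N := ⟨inferInstance⟩
  obtain ⟨x, hx, hd⟩ := exists_ofDiffAt L hab' fun y => c y N
  exact H x hx N le_rfl hd

variable (L) in
-- The bad points form a definable set containing no interval, so near each end of the line there
-- are none. Outside the bad set, the dichotomy in `g` turns failure of eventual
-- non-differentiability into eventual differentiability.
theorem exists_bounded_bad_set (c : M → M → M) [DefFun₂ L c] : ∃ p q : M, ∀ x, x < p ∨ q < x →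
    ∀ᶠ g in atTop, OFDiffAt (fun y => c y g) x := by
  have key : ∀ x, ¬ (∃ N, ∀ g, N ≤ g → ¬ OFDiffAt (fun y => c y g) x) →
      ∀ᶠ g in atTop, OFDiffAt (fun y => c y g) x := fun x hx =>
    (decidesConvex_atTop.eventually_or L _).resolve_right fun h => hx (eventually_atTop.1 h)
  have htop : ∀ᶠ x in atTop, ¬ ∃ N, ∀ g, N ≤ g → ¬ OFDiffAt (fun y => c y g) x := by
    refine (decidesConvex_atTop.eventually_or L _).resolve_left fun h => ?_
    obtain ⟨t, ht⟩ := eventually_atTop.1 h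
    exact not_holds_not_ofDiffAt L c (lt_add_one t) fun x hx => ht x hx.1.le
  have hbot : ∀ᶠ x in atBot, ¬ ∃ N, ∀ g, N ≤ g → ¬ OFDiffAt (fun y => c y g) x := by
    refine (decidesConvex_atBot.eventually_or L _).resolve_left fun h => ?_
    obtain ⟨t, ht⟩ := eventually_atBot.1 h
    exact not_holds_not_ofDiffAt L c (sub_one_lt t) fun x hx => ht x hx.2.le
  obtain ⟨q, hq⟩ := eventually_atTop.1 htop
  obtain ⟨p, hp⟩ := eventually_atBot.1 hbot
  refine ⟨p, q, ?_⟩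
  rintro x (hx | hx)
  · exact key x (hp x hx.le)
  · exact key x (hq x hx.le)

variable (hop : IsDefinableOrderedGroup L op) (hcomm : ∀ x y, op x y = op y x)
  (hd : ∀ t s, OFDiffAt (fun x => op x s) t)

include hop hcomm hd

/-- Off a bounded set a symmetric definable cocycle is differentiable. -/
theorem exists_ofDiffAt_cocycle (c : M → M → M) [DefFun₂ L c]
    (hc : ∀ g h k, c h k - c (op g h) k + c g (op h k) - c g h = 0) (hs : ∀ x y, c x y = c y x) :
    ∃ p q : M, p < q ∧ ∀ x k, (x < p ∨ q < x) → (op x k < p ∨ q < op x k) →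
      OFDiffAt (fun y => c y k) x := by
  obtain ⟨p, q, h⟩ := exists_bounded_bad_set L c
  -- Nothing is known about the order of the two bounds, so the interval is enlarged to be
  -- nondegenerate.
  refine ⟨min p q, max p q + 1, ?_, fun x k hx hxk => ?_⟩
  · exact (min_le_max).trans_lt (lt_add_one _)
  have aux : ∀ x, x < min p q ∨ max p q + 1 < x → x < p ∨ q < x := by
    rintro x (hx | hx)
    · exact .inl (hx.trans_le (min_le_left _ _))
    · exact .inr (((le_max_right p q).trans_lt (lt_add_one _)).trans hx)
  have ht : Tendsto (fun g => op g x) atTop atTop :=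
    (hop.strictMono_left x).monotone.tendsto_atTop_atTop fun b =>
      ⟨op b (hop.inv x), (hop.op_inv_op' b x).ge⟩
  -- For large `g`, the function `c(·, g)` is differentiable at `x` and at `x ⊕ k`, and `c(·, k)` is
  -- differentiable at `g ⊕ x`. By the cocycle identity for `(g, y, k)` and symmetry, these are all
  -- that is needed.
  obtain ⟨g, ⟨h1, h2⟩, h3⟩ := (((h x (aux x hx)).and (h _ (aux _ hxk))).and
    (ht.eventually (eventually_ofDiffAt L c k))).exists
  have e : (fun y => c y k) = fun y => c (op y g) k - c (op y k) g + c y g := by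
    funext y
    have := hc g y k
    rw [hs g (op y k), hs g y, hcomm g y] at this
    linear_combination this
  rw [e]
  rw [hcomm] at h3
  exact ((OFDiffAt.comp (f := fun y => op y g) (g := fun z => c z k) h3 (hd _ _)).sub
    (OFDiffAt.comp (f := fun y => op y k) (g := fun z => c z g) h2 (hd _ _))).add h1

/-- A symmetric definable cocycle is cohomologous to one that is differentiable in the first
variable. -/
theorem exists_smoothing (c : M → M → M) [DefFun₂ L c]
    (hc : ∀ g h k, c h k - c (op g h) k + c g (op h k) - c g h = 0) (hs : ∀ x y, c x y = c y x) :
    ∃ β : M → M, DefFun₁ L β ∧ ∀ t s, OFDiffAt (fun x => c x s + β x - β (op x s)) t := by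
  obtain ⟨p, q, hpq, hgood⟩ := exists_ofDiffAt_cocycle hop hcomm hd c hc hs
  have hcont : ∀ s, Continuous fun x => op x s := fun s =>
    continuous_iff_continuousAt.2 fun t => (hd t s).choose_spec.continuousAt
  -- A difference of two values of the cocycle needs no condition on `x` itself: with `k ⊕ m = k'`
  -- it is a constant minus `c(y ⊕ k, m)`.
  have hdiff : ∀ x k k', (op x k < p ∨ q < op x k) → (op x k' < p ∨ q < op x k') →
      OFDiffAt (fun y => c y k - c y k') x := by
    intro x k k' hk hk'
    set m := op (hop.inv k) k'
    have hm : op k m = k' := hop.op_inv_op k k'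
    have e : (fun y => c y k - c y k') = fun y => c k m - c (op y k) m := by
      funext y
      have := hc y k m
      rw [hm] at this
      linear_combination -this
    rw [e]
    refine (OFDiffAt.const _ _).sub
      (OFDiffAt.comp (f := fun y => op y k) (g := fun z => c z m) (hgood _ _ hk ?_) (hd _ _))
    rwa [hop.assoc, hm]
  -- Translation by `k₀` takes `p` to `q + 1`, hence `[p, ∞)` beyond `q`.
  set k₀ := op (hop.inv p) (q + 1) with hk₀
  have hlarge : ∀ x, p ≤ x → q < op x k₀ := fun x hx => by
    refine (lt_add_one q).trans_le ?_
    rw [← hop.op_inv_op p (q + 1)]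
    exact (hop.strictMono_left k₀).monotone hx
  -- There is room to the left of `p`: the half-line from `a` is still translated beyond `q`, while
  -- `a` lies outside `[p, q]`, so that `c(·, k₀)` is differentiable at `a`.
  obtain ⟨a, hra, hap⟩ : ∃ a, op q (hop.inv k₀) < a ∧ a < p := by
    refine exists_between ?_
    rw [← hop.lt_iff_left k₀, hop.op_inv_op']
    exact hlarge p le_rfl
  have hlarge' : ∀ x, a ≤ x → q < op x k₀ := fun x hx => by
    rw [← hop.op_inv_op' q k₀, hop.lt_iff_left]
    exact hra.trans_le hx
  obtain ⟨e, he⟩ := hgood a k₀ (.inl hap) (.inr (hlarge' a le_rfl))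
  -- To the left of `a` stands the tangent line of `-c(·, k₀)` at `a`, so value and derivative match
  -- at the junction.
  set β : M → M := fun x => if a ≤ x then - c x k₀ else (- c a k₀ + e * a) + -e * x with hβ
  have hop₂ := hop.defFun₂
  have hright : ∀ x, a ≤ x → β x = - c x k₀ := fun x hx => if_pos hx
  have hleft : ∀ x, x ≤ a → β x = (- c a k₀ + e * a) + -e * x := by
    intro x hx
    rcases hx.lt_or_eq with h | rfl
    · exact if_neg h.not_ge
    · rw [hright x le_rfl]; ring
  have hev : ∀ x, a < x → ∀ᶠ y in 𝓝 x, β y = - c y k₀ := fun x hx => by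
    filter_upwards [Ioi_mem_nhds hx] with y hy using hright y (le_of_lt hy)
  have hβd : ∀ x, (x < p ∨ q < x) → OFDiffAt β x := by
    intro x hx
    rcases lt_trichotomy x a with h | rfl | h
    · refine OFDiffAt.congr_of_eventuallyEq ⟨_, .linear (- c a k₀ + e * a) (-e) x⟩ ?_
      filter_upwards [Iio_mem_nhds h] with y hy using hleft y (le_of_lt hy)
    · exact ⟨-e, he.neg.of_sides (.linear (- c x k₀ + e * x) (-e) x) hright hleft⟩
    · exact (hgood x k₀ hx (.inr (hlarge' x h.le))).neg.congr_of_eventuallyEq (hev x h)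
  refine ⟨β, ⟨inferInstance⟩, fun t s => ?_⟩
  have hin : ∀ x, ¬ (x < p ∨ q < x) → p ≤ x := fun x hx => by
    simp only [not_or, not_lt] at hx; exact hx.1
  have hβc : ∀ x, (op x s < p ∨ q < op x s) → OFDiffAt (fun y => β (op y s)) x := fun x hx =>
    OFDiffAt.comp (f := fun y => op y s) (hβd _ hx) (hd _ _)
  have hevs : ∀ x, a < op x s → ∀ᶠ y in 𝓝 x, β (op y s) = - c (op y s) k₀ := fun x hx =>
    (hcont s).continuousAt.eventually (hev _ hx)
  have hcs : ∀ y, c y s + c (op y s) k₀ = c s k₀ + c y (op s k₀) := fun y => by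
    linear_combination -hc y s k₀
  -- When `t ⊕ s` is in `[p, q]`, the term `-β(y ⊕ s)` is `c(y ⊕ s, k₀)`, and `hcs` replaces its sum
  -- with `c(y, s)` by `c(s, k₀) + c(y, s ⊕ k₀)`. When `t` is in `[p, q]`, the term `β y` is `-c(y,
  -- k₀)`, and `hdiff` applies to the resulting difference.
  by_cases h1 : t < p ∨ q < t <;> by_cases h2 : op t s < p ∨ q < op t s
  · exact ((hgood t s h1 h2).add (hβd t h1)).sub (hβc t h2)
  · have hp := hin _ h2
    have : OFDiffAt (fun y => β y + (c s k₀ + c y (op s k₀))) t := by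
      refine (hβd t h1).add ((OFDiffAt.const _ _).add (hgood t _ h1 (.inr ?_)))
      rw [← hop.assoc]; exact hlarge _ hp
    refine this.congr_of_eventuallyEq ?_
    filter_upwards [hevs t (hap.trans_le hp)] with y hy
    rw [hy, ← hcs]; ring
  · have hp := hin _ h1
    refine ((hdiff t s k₀ h2 (.inr (hlarge t hp))).sub (hβc t h2)).congr_of_eventuallyEq ?_
    filter_upwards [hev t (hap.trans_le hp)] with y hy
    rw [hy]; ring
  · have hp := hin _ h1
    have hp2 := hin _ h2
    have : OFDiffAt (fun y => c s k₀ + (c y (op s k₀) - c y k₀)) t := by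
      refine (OFDiffAt.const _ _).add (hdiff t _ _ (.inr ?_) (.inr (hlarge t hp)))
      rw [← hop.assoc]; exact hlarge _ hp2
    refine this.congr_of_eventuallyEq ?_
    filter_upwards [hev t (hap.trans_le hp), hevs t (hap.trans_le hp2)] with y hy hy2
    rw [hy, hy2]; linear_combination hcs y

omit hcomm in
/-- A definable primitive of a cocycle that is differentiable in the first variable is
differentiable. -/
theorem ofDiffAt_primitive (c : M → M → M) (hcd : ∀ t s, OFDiffAt (fun x => c x s) t)
    (b : M → M) [DefFun₁ L b] (hb : ∀ g h, c g h = b (op g h) - b g - b h) (y : M) :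
    OFDiffAt b y := by
  obtain ⟨x, -, hx⟩ := exists_ofDiffAt L (zero_lt_one (α := M)) b
  -- Translation by the inverse of `s` carries `y` to the point `x` where `b` is known to be
  -- differentiable.
  set s := op (hop.inv x) y with hs
  have hy : op y (hop.inv s) = x := by
    rw [← hop.op_op_inv x s, hs, hop.op_inv_op]
  have e : b = fun z => c (op z (hop.inv s)) s + b (op z (hop.inv s)) + b s := by
    funext z
    rw [hb, hop.op_inv_op']; ring
  rw [e]
  rw [← hy] at hx
  exact ((OFDiffAt.comp (f := fun z => op z (hop.inv s)) (g := fun z => c z s) (hcd _ _)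
    (hd _ _)).add (OFDiffAt.comp (f := fun z => op z (hop.inv s)) (g := b) hx (hd _ _))).add
    (OFDiffAt.const _ _)

omit hcomm in
/-- A definable cocycle differentiable in the first variable is a definable coboundary if and only
if the associated linear differential equation has a definable solution. -/
theorem exists_primitive_iff (c dc dop : M → M → M) [DefFun₂ L c]
    (hc : ∀ g h k, c h k - c (op g h) k + c g (op h k) - c g h = 0)
    (hdc : ∀ t s, HasOrderedFieldDerivAt (fun x => c x s) (dc t s) t)
    (hdop : ∀ t s, HasOrderedFieldDerivAt (fun x => op x s) (dop t s) t) :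
    (∃ b : M → M, DefFun₁ L b ∧ ∀ g h, c g h = b (op g h) - b g - b h) ↔
      ∃ α dα : M → M, DefFun₁ L α ∧ (∀ s, HasOrderedFieldDerivAt α (dα s) s) ∧
        ∀ s, dα s * dop 0 s = dα 0 + dc 0 s := by
  constructor
  · rintro ⟨b, hb, h⟩
    choose db hdb using ofDiffAt_primitive hop hd c (fun t s => ⟨_, hdc t s⟩) b h
    refine ⟨b, db, hb, hdb, fun s => ?_⟩
    have h1 := HasOrderedFieldDerivAt.comp (f := fun x => op x s) (x := 0)
      (by rw [hop.zero_op]; exact hdb s) (hdop 0 s)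
    have h2 := (((hdb 0).add (hdc 0 s)).add (.const (b s) 0))
    have e : (fun y => b y + c y s + b s) = fun y => b (op y s) := by
      funext y; rw [h]; ring
    rw [e, add_zero] at h2
    exact h1.unique h2
  · rintro ⟨α, dα, hα, hdα, h⟩
    -- The equation says precisely that this cohomologous cocycle has zero derivative in `x` at `(0,
    -- s)`.
    set c' : M → M → M := fun x s => c x s + α x + α s - α (op x s) with hc'
    have hop₂ := hop.defFun₂
    have hcoc : ∀ g h k, c' h k - c' (op g h) k + c' g (op h k) - c' g h = 0 := fun g h k => by
      simp only [hc', hop.assoc]; linear_combination hc g h k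
    have h0 : ∀ s, HasOrderedFieldDerivAt (fun x => c' x s) 0 0 := fun s => by
      have h1 := HasOrderedFieldDerivAt.comp (f := fun x => op x s) (x := 0)
        (by rw [hop.zero_op]; exact hdα s) (hdop 0 s)
      have h2 := (((hdc 0 s).add (hdα 0)).add (.const (α s) 0)).sub h1
      rwa [h, show dc 0 s + dα 0 + 0 - (dα 0 + dc 0 s) = 0 by ring] at h2
    -- The cocycle identity for `(x ⊖ y, y, k)` moves the vanishing of the derivative from `0` to
    -- `y`.
    have hall : ∀ k y, HasOrderedFieldDerivAt (fun x => c' x k) 0 y := fun k y => by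
      have e : (fun x => c' x k) = fun x =>
          c' y k + c' (op x (hop.inv y)) (op y k) - c' (op x (hop.inv y)) y := by
        funext x
        have := hcoc (op x (hop.inv y)) y k
        rw [hop.op_inv_op'] at this
        linear_combination -this
      have hz : ∀ s, HasOrderedFieldDerivAt (fun x => c' (op x (hop.inv y)) s)
          (0 * dop y (hop.inv y)) y := fun s =>
        HasOrderedFieldDerivAt.comp (f := fun x => op x (hop.inv y)) (g := fun z => c' z s)
          (by rw [hop.op_inv]; exact h0 s) (hdop y (hop.inv y))
      have := ((HasOrderedFieldDerivAt.const (c' y k) y).add (hz (op y k))).sub (hz y)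
      rw [e]
      simpa using this
    have hconst : ∀ x k, c' x k = c' 0 0 := fun x k => by
      have : DefFun₁ L fun x => c' x k := ⟨inferInstance⟩
      have h1 := eq_of_hasDeriv_zero L (fun x => c' x k) (hall k) x 0
      have h2 := hcoc 0 0 k
      simp only [hop.zero_op] at h2
      linear_combination h1 + h2
    -- Subtracting the constant `c' 0 0` from `α` adds it once to the coboundary `α(x ⊕ k) - α(x) -
    -- α(k)`.
    refine ⟨fun x => α x - c' 0 0, ⟨inferInstance⟩, fun x k => ?_⟩
    have h1 := hconst x k
    have h2 : c' x k = c x k + α x + α k - α (op x k) := rfl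
    linear_combination h1 - h2

end Cocycles

/-! ### Sections, cocycles and splittings of definable extensions -/

section Extensions

variable {L : Language} {M : Type*} [Field M] [LinearOrder M] [L.Structure M]
  [hM : Fact (IsOMinimalExpansion L M)] [IsStrictOrderedRing M] {op : M → M → M}
  {n : ℕ} {U : Set (Fin n → M)} [CommGroup U] {i : M → U} {j : U → M}

theorem DefFun₁.isDefinableMap_iff {f : M → M} : IsDefinableMap L M f ↔ DefFun₁ L f := by
  constructor
  · exact fun h => ⟨(h.comp_defMap (DefFun.var (0 : Fin 1)).defMap).defFun⟩
  · exact fun h => .of_defMap h.out.defMap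

theorem IsDefinableGroup.mul_defMap (hU : IsDefinableGroup L U) {ι : Type} {F G : (ι → M) → U}
    (hF : DefMap L F) (hG : DefMap L G) : DefMap L fun v => F v * G v :=
  hU.mul.comp_defMap (hF.prodMk hG)

theorem DefFun.comp_isDefinableMap {f : M → U} (hf : IsDefinableMap L M f) {ι : Type}
    {g : (ι → M) → M} (hg : DefFun L g) : DefMap L fun v => f (g v) := hf.comp_defMap hg.defMap

/-- A definable surjection onto the line has a definable section. -/
theorem exists_definable_section (hj : IsDefinableMap L M j) (hsurj : Function.Surjective j) :
    ∃ s : M → U, IsDefinableMap L M s ∧ ∀ g, j (s g) = g := by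
  have hp : DefPred L fun w : Fin 1 ⊕ Fin n → M =>
      ∃ u : U, u.1 = (fun k => w (.inr k)) ∧ j u = w (.inl 0) := by
    refine (DefPred.reindex (L := L) (Sum.elim (fun k => .inr k) (fun _ => .inl 0) :
      Fin n ⊕ Unit → Fin 1 ⊕ Fin n) ⟨hj⟩).congr fun w => exists_congr fun u => ?_
    constructor
    · exact fun h => ⟨funext fun k => congrFun h (.inl k), congrFun h (.inr ())⟩
    · rintro ⟨h1, h2⟩
      refine funext fun k => ?_
      rcases k with k | k
      · exact congrFun h1 k
      · exact h2
  obtain ⟨f, hf, h⟩ := exists_defFun_tuple (L := L) n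
    (fun (v : Fin 1 → M) (y : Fin n → M) => ∃ u : U, u.1 = y ∧ j u = v 0) hp
  choose s hs hs' using fun g => h (fun _ => g) (by
    obtain ⟨u, hu⟩ := hsurj g
    exact ⟨u.1, u, rfl, hu⟩)
  refine ⟨s, .of_defMap fun k => ?_, hs'⟩
  have : (fun v : Fin 1 → M => Coordinates.coord (M := M) (s (v 0)) k) = fun v => f v k := by
    funext v
    have e : (fun _ => v 0) = v := funext fun k => by rw [Subsingleton.elim k 0]
    have := congrFun (hs (v 0)) k
    rw [e] at this
    exact this
  rw [this]
  exact hf k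

theorem IsDefinableExtension.j_one (hop : IsDefinableOrderedGroup L op)
    (hU : IsDefinableExtension L op U i j) : j 1 = 0 := by
  have h := hU.j_hom 1 1
  rw [mul_one] at h
  have e := hop.inv_op_op (j 1) (j 1)
  rw [← h, hop.inv_op] at e
  exact e.symm

theorem IsDefinableExtension.j_i (hU : IsDefinableExtension L op U i j) (a : M) : j (i a) = 0 :=
  (hU.exact _).2 ⟨a, rfl⟩

theorem IsDefinableExtension.j_inv (hop : IsDefinableOrderedGroup L op)
    (hU : IsDefinableExtension L op U i j) (u : U) : j u⁻¹ = hop.inv (j u) := by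
  rw [← hop.inv_op_op (j u) (j u⁻¹), ← hU.j_hom, mul_inv_cancel, hU.j_one hop, hop.op_zero]

theorem IsDefinableExtension.exists_i_mul (hop : IsDefinableOrderedGroup L op)
    (hU : IsDefinableExtension L op U i j) {u v : U} (h : j u = j v) : ∃ a, i a * v = u := by
  obtain ⟨a, ha⟩ := (hU.exact (u * v⁻¹)).1 (by rw [hU.j_hom, hU.j_inv hop, h, hop.op_inv])
  exact ⟨a, by rw [ha, inv_mul_cancel_right]⟩

theorem IsDefinableExtension.op_comm (hU : IsDefinableExtension L op U i j) (x y : M) :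
    op x y = op y x := by
  obtain ⟨u, rfl⟩ := hU.j_surjective x
  obtain ⟨v, rfl⟩ := hU.j_surjective y
  rw [← hU.j_hom, ← hU.j_hom, mul_comm]

/-- The cocycle of a definable section. -/
theorem IsDefinableExtension.exists_cocycle (hop : IsDefinableOrderedGroup L op)
    (hU : IsDefinableExtension L op U i j) {s : M → U} (hs : IsDefinableMap L M s)
    (hjs : ∀ g, j (s g) = g) : ∃ c : M → M → M, DefFun₂ L c ∧
      (∀ g h, i (c g h) * s (op g h) = s g * s h) ∧
      (∀ g h k, c h k - c (op g h) k + c g (op h k) - c g h = 0) ∧ ∀ x y, c x y = c y x := by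
  choose c hc using fun g h => hU.exists_i_mul hop (u := s g * s h) (v := s (op g h))
    (by simp only [hU.j_hom, hjs])
  have hop₂ := hop.defFun₂
  refine ⟨c, ⟨.of_graph ?_⟩, hc, fun g h k => ?_, fun x y => hU.i_injective ?_⟩
  · refine ((hU.group.mul_defMap (DefFun.comp_isDefinableMap hU.i_definable (DefFun.var none))
      (DefFun.comp_isDefinableMap hs (inferInstance : DefFun L fun w : Option (Fin 2) → M =>
        op (w (some 0)) (w (some 1))))).eq (hU.group.mul_defMap
      (DefFun.comp_isDefinableMap hs (DefFun.var (some 0)))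
      (DefFun.comp_isDefinableMap hs (DefFun.var (some 1))))).congr fun w => ?_
    rw [← hc, mul_left_inj, hU.i_injective.eq_iff]
  · have e : i (c h k + c g (op h k)) = i (c (op g h) k + c g h) := by
      rw [hU.i_hom, hU.i_hom, ← mul_left_inj (s (op g (op h k)))]
      calc i (c h k) * i (c g (op h k)) * s (op g (op h k))
          = i (c h k) * (s g * s (op h k)) := by rw [← hc, mul_assoc]
        _ = s g * (s h * s k) := by rw [← hc h k, mul_left_comm]
        _ = i (c g h) * (s (op g h) * s k) := by rw [← mul_assoc, ← hc g h, mul_assoc]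
        _ = i (c (op g h) k) * i (c g h) * s (op g (op h k)) := by
          rw [← hc, hop.assoc, ← mul_assoc, mul_comm (i _) (i _)]
    have := hU.i_injective e
    linear_combination this
  · rw [← mul_left_inj (s (op x y)), hc, hU.op_comm x y, hc, mul_comm]

/-- A definable homomorphism from a definable ordered group that is not killed by the projection
yields a definable splitting. -/
theorem IsDefinableExtension.exists_splitting (hop : IsDefinableOrderedGroup L op)
    (hU : IsDefinableExtension L op U i j) {op₁ : M → M → M} (h₁ : IsDefinableOrderedGroup L op₁)
    {σ : M → U} (hσ : IsDefinableMap L M σ) (hhom : ∀ x y, σ (op₁ x y) = σ x * σ y) {x : M}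
    (hx : j (σ x) ≠ 0) : ∃ τ : M → U, IsDefinableMap L M τ ∧ (∀ g, j (τ g) = g) ∧
      ∀ g h, τ (op g h) = τ g * τ h := by
  have hψ : DefFun₁ L fun x => j (σ x) :=
    ⟨(hU.j_definable.comp_defMap (DefFun.comp_isDefinableMap hσ (DefFun.var 0))).defFun⟩
  -- `j ∘ σ` is bijective, so `σ` composed with its inverse is a homomorphic section of `j`.
  have hb := h₁.bijective_of_hom hop (fun x => j (σ x)) (fun x y => by rw [hhom, hU.j_hom]) hx
  obtain ⟨χ, hχ⟩ := hb.surjective.hasRightInverse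
  have hχd : DefFun₁ L χ := by
    refine ⟨.of_graph (DefPred.congr (p := fun w => j (σ (w none)) = w (some 0)) ?_ fun w => ?_)⟩
    · exact DefPred.eq (hf := DefFun₁.comp (F := fun x => j (σ x)))
    · exact ⟨fun h => hb.injective (h.trans (hχ _).symm), fun h => by rw [h]; exact hχ _⟩
  refine ⟨fun g => σ (χ g), .of_defMap (DefFun.comp_isDefinableMap hσ hχd.out), hχ, fun g h => ?_⟩
  rw [← hhom]
  refine congrArg σ (hb.injective ?_)
  have e : ∀ y, j (σ (χ y)) = y := hχ
  simp only [hhom, hU.j_hom, e]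

/-- The middle group is definably the product of the outer groups if and only if the cocycle of a
definable section is the coboundary of a definable function. -/
theorem IsDefinableExtension.isDefinablyIsoProd_iff (hop : IsDefinableOrderedGroup L op)
    (hU : IsDefinableExtension L op U i j) {s : M → U} (hs : IsDefinableMap L M s)
    (hjs : ∀ g, j (s g) = g) {c : M → M → M}
    (hc : ∀ g h, i (c g h) * s (op g h) = s g * s h) :
    IsDefinablyIsoProd L op U ↔
      ∃ b : M → M, DefFun₁ L b ∧ ∀ g h, c g h = b (op g h) - b g - b h := by
  constructor
  · rintro ⟨φ, hφ, hhom⟩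
    have hφs := hφ.symm
    have hσ : ∀ p q : M × M, φ.symm (p.1 + q.1, op p.2 q.2) = φ.symm p * φ.symm q := fun p q => by
      rw [Equiv.symm_apply_eq, hhom, Equiv.apply_symm_apply, Equiv.apply_symm_apply]
    obtain ⟨τ, hτ, hjτ, hτhom⟩ : ∃ τ : M → U, IsDefinableMap L M τ ∧ (∀ g, j (τ g) = g) ∧
        ∀ g h, τ (op g h) = τ g * τ h := by
      -- `u` is the product of its components in the two factors, and `j u = 1 ≠ 0`, so `j` is
      -- nonzero on the component from `(M, op)` or on the one from `(M, +)`.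
      obtain ⟨u, hu⟩ := hU.j_surjective 1
      by_cases h : j (φ.symm (0, (φ u).2)) = 0
      · refine hU.exists_splitting hop hM.out.isDefinableOrderedGroup_add
          (σ := fun a => φ.symm (a, 0))
          (.of_defMap (hφs.comp_defMap ((DefFun.var 0).defMap.prodMk (DefFun.const 0).defMap)))
          (fun x y => ?_) (x := (φ u).1) fun h' => ?_
        · rw [← hσ]
          simp only [hop.op_zero]
        · have := hσ ((φ u).1, 0) (0, (φ u).2)
          simp only [add_zero, hop.zero_op, Prod.mk.eta, Equiv.symm_apply_apply] at this
          rw [this, hU.j_hom, h, h', hop.op_zero] at hu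
          exact zero_ne_one hu
      · refine hU.exists_splitting hop hop (σ := fun a => φ.symm (0, a))
          (.of_defMap (hφs.comp_defMap ((DefFun.const 0).defMap.prodMk (DefFun.var 0).defMap)))
          (fun x y => ?_) h
        rw [← hσ]
        simp only [add_zero]
    -- `b` measures the splitting `τ` against the section `s`; as `τ` is a homomorphism, the
    -- coboundary of `b` is `c`.
    choose b hb using fun g => hU.exists_i_mul hop (u := τ g) (v := s g) (by rw [hjτ, hjs])
    refine ⟨b, ⟨.of_graph ?_⟩, fun g h => ?_⟩
    · refine ((hU.group.mul_defMap (DefFun.comp_isDefinableMap hU.i_definable (DefFun.var none))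
        (DefFun.comp_isDefinableMap hs (DefFun.var (some 0)))).eq
        (DefFun.comp_isDefinableMap hτ (DefFun.var (some 0)))).congr fun w => ?_
      rw [← hb, mul_left_inj, hU.i_injective.eq_iff]
    · have e : i (c g h + b g + b h) = i (b (op g h)) := by
        rw [hU.i_hom, hU.i_hom, ← mul_left_inj (s (op g h)), hb, hτhom, ← hb g, ← hb h]
        calc i (c g h) * i (b g) * i (b h) * s (op g h)
            = i (c g h) * s (op g h) * (i (b g) * i (b h)) := by
              simp only [mul_comm, mul_left_comm]
          _ = _ := by rw [hc, mul_mul_mul_comm, mul_comm (s g), mul_comm (s h)]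
      have := hU.i_injective e
      linear_combination this
  · rintro ⟨b, hb, hcb⟩
    set τ : M → U := fun g => i (b g) * s g with hτ
    have hτhom : ∀ g h, τ (op g h) = τ g * τ h := fun g h => by
      have : b (op g h) = b g + b h + c g h := by rw [hcb]; ring
      simp only [hτ]
      rw [this, hU.i_hom, mul_assoc, hc, hU.i_hom, mul_mul_mul_comm]
    have hjτ : ∀ g, j (τ g) = g := fun g => by
      simp only [hτ]
      rw [hU.j_hom, hU.j_i, hjs, hop.zero_op]
    have hτd : IsDefinableMap L M τ := .of_defMap (hU.group.mul_defMap
      (DefFun.comp_isDefinableMap hU.i_definable hb.out)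
      (DefFun.comp_isDefinableMap hs (DefFun.var 0)))
    have hj : ∀ a g, j (i a * τ g) = g := fun a g => by
      rw [hU.j_hom, hU.j_i, hjτ, hop.zero_op]
    let θ : M × M ≃ U := Equiv.ofBijective (fun p => i p.1 * τ p.2) ⟨fun p q h => by
      have h2 : p.2 = q.2 := by
        rw [← hj p.1 p.2, ← hj q.1 q.2]; exact congrArg j h
      beta_reduce at h
      rw [h2, mul_left_inj] at h
      exact Prod.ext (hU.i_injective h) h2, fun u => by
      obtain ⟨a, ha⟩ := hU.exists_i_mul hop (u := u) (v := τ (j u)) (hjτ _).symm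
      exact ⟨(a, j u), ha⟩⟩
    have hθ : ∀ p, θ p = i p.1 * τ p.2 := fun _ => rfl
    refine ⟨θ.symm, IsDefinableMap.symm (.of_defMap₂ (hU.group.mul_defMap
      (DefFun.comp_isDefinableMap hU.i_definable (DefFun.var 0))
      (DefFun.comp_isDefinableMap hτd (DefFun.var 1)))), fun u v => ?_⟩
    rw [Equiv.symm_apply_eq, hθ, hU.i_hom, hτhom, mul_mul_mul_comm, ← hθ, ← hθ]
    simp only [Equiv.apply_symm_apply]

end Extensions

/-! ### The cocycle differentiable in its first variable and the criterion for a product -/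

theorem mainTheorem12 {I : Type*} [Field I] [LinearOrder I] [IsStrictOrderedRing I]
    [IsRealClosed I] (L : Language) [L.Structure I] (hI : IsOMinimalExpansion L I)
    (op : I → I → I) (hop : IsDefinableOrderedGroup L op)
    (dop : I → I → I) (hdop : ∀ t s, HasOrderedFieldDerivAt (fun x => op x s) (dop t s) t)
    {n : ℕ} (U : Set (Fin n → I)) [CommGroup U] (i : I → U) (j : U → I)
    (hU : IsDefinableExtension L op U i j) :
    ∃ c dc : I → I → I,
      IsDefinableTwoCocycle L op c ∧
      CorrespondsToExtension L op U i j c ∧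
      (∀ t s, HasOrderedFieldDerivAt (fun x => c x s) (dc t s) t) ∧
      (IsDefinablyIsoProd L op U ↔
        ∃ α dα : I → I, IsDefinableMap L I α ∧ (∀ s, HasOrderedFieldDerivAt α (dα s) s) ∧
          ∀ s, dα s * dop 0 s = dα 0 + dc 0 s) := by
  have : Fact (IsOMinimalExpansion L I) := ⟨hI⟩
  let _ := Preorder.topology I
  have : OrderTopology I := ⟨rfl⟩
  have hd : ∀ t s, OFDiffAt (fun x => op x s) t := fun t s => ⟨_, hdop t s⟩
  have hop₂ := hop.defFun₂
  obtain ⟨s₀, hs₀, hjs₀⟩ := exists_definable_section hU.j_definable hU.j_surjective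
  obtain ⟨c₀, hc₀, hic₀, hcoc₀, hsymm⟩ := hU.exists_cocycle hop hs₀ hjs₀
  obtain ⟨β, hβ, hdiff⟩ := exists_smoothing hop hU.op_comm hd c₀ hcoc₀ hsymm
  -- Shifting the section by `i ∘ β` realises the smoothing of `c₀` within the same extension.
  have hs : IsDefinableMap L I fun g => i (β g) * s₀ g := .of_defMap (hU.group.mul_defMap
    (DefFun.comp_isDefinableMap hU.i_definable hβ.out)
    (DefFun.comp_isDefinableMap hs₀ (DefFun.var 0)))
  have hjs : ∀ g, j (i (β g) * s₀ g) = g := fun g => by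
    rw [hU.j_hom, hU.j_i, hjs₀, hop.zero_op]
  obtain ⟨c, hc, hic, hcoc, -⟩ := hU.exists_cocycle hop hs hjs
  have hcc₀ : ∀ g h, c g h = c₀ g h + β g - β (op g h) + β h := fun g h => by
    have e : i (c g h + β (op g h)) = i (c₀ g h + β g + β h) := by
      simp only [hU.i_hom]
      rw [← mul_left_inj (s₀ (op g h)), mul_assoc, hic, mul_mul_mul_comm, ← hic₀]
      simp only [mul_comm, mul_left_comm]
    have := hU.i_injective e
    linear_combination this
  have hcd : ∀ t s, OFDiffAt (fun x => c x s) t := fun t s => by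
    simp only [hcc₀]
    -- The full coboundary also contains the term `β s`, which is constant in the first variable.
    exact (hdiff t s).add (.const _ _)
  choose dc hdc using hcd
  refine ⟨c, dc, ⟨.of_defMap₂ hc.out.defMap, hcoc⟩, ⟨_, hs, hjs, fun g h => ?_⟩, hdc, ?_⟩
  · rw [← hic, mul_inv_cancel_right]
  · simp only [DefFun₁.isDefinableMap_iff]
    exact (hU.isDefinablyIsoProd_iff hop hs hjs hic).trans
      (exists_primitive_iff hop hd c dc dop hcoc hdc hdop)
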